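/- Let $N\ge 2$, let $\mathbb H^N$ be the $N$-dimensional hyperbolic space (constant curvature $-1$) with Riemannian gradient $\nabla$ and volume measure $dv$, fix $x_0\in\mathbb H^N$, let $r=d(x,x_0)$ be the geodesic distance, and let $\nabla_r u=\langle\nabla u,\nabla r\rangle\nabla r=(\partial u/\partial r,0)$ denote the radial part of the gradient in geodesic polar coordinates around $x_0$. For $0\le\lambda\le\lambda_1(\mathbb H^N)=\left(\frac{N-1}{2}\right)^2$ put $$\gamma_N(\lambda)=\sqrt{(N-1)^2-4\lambda},\qquad h_N(\lambda)=\frac{\gamma_N(\lambda)+1}{2},\qquad \Psi_\lambda(r)=r^{-\frac{N-2}{2}}\left(\frac{\sinh r}{r}\right)^{-\frac{N-1+\gamma_N(\lambda)}{2}}.$$ Then for every $0\le\lambda\le\lambda_1(\mathbb H^N)$ and every $u\in C_c^\infty(\mathbb H^N\setminus\{x_0\})$ all the integrals below are finite and $$\int|\nabla u|^2dv=\lambda\int u^2dv+h_N^2(\lambda)\int\frac{u^2}{r^2}dv+\left[\frac{(N-2)^2}{4}-h_N^2(\lambda)\right]\int\frac{u^2}{\sinh^2 r}dv+\gamma_N(\lambda)h_N(\lambda)\int\frac{r\coth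 r-1}{r^2}u^2dv+\int\Psi_\lambda(r)^2\left|\nabla\left(\frac{u}{\Psi_\lambda(r)}\right)\right|^2dv,$$ and the same identity holds for the radial gradient: $$\int|\nabla_r u|^2dv=\lambda\int u^2dv+h_N^2(\lambda)\int\frac{u^2}{r^2}dv+\left[\frac{(N-2)^2}{4}-h_N^2(\lambda)\right]\int\frac{u^2}{\sinh^2 r}dv+\gamma_N(\lambda)h_N(\lambda)\int\frac{r\coth r-1}{r^2}u^2dv+\int\Psi_\lambda(r)^2\left|\nabla_r\left(\frac{u}{\Psi_\lambda(r)}\right)\right|^2dv.$$ In particular (the case $\lambda=N-2$), if $N\ge 3$ then for every $u\in C_c^\infty(\mathbb H^N\setminus\{x_0\})$ $$\int|\nabla u|^2dv=\left(\frac{N-2}{2}\right)^2\int\frac{u^2}{r^2}dv+(N-2)\int u^2dv+\frac{(N-2)(N-3)}{2}\int\frac{r\coth r-1}{r^2}u^2dv+\int\left(\frac{r^{1/2}}{\sinh r}\right)^{2(N-2)}\left|\nabla\left(\frac{(\sinh r)^{N-2}u}{r^{(N-2)/2}}\right)\right|^2dv.$$ -/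

import Mathlib

open MeasureTheory Set
open scoped ContDiff

/-- The underlying set of the Poincaré ball model of hyperbolic `N`-space: the open Euclidean
unit ball of `ℝ^N`. -/
def hypSpace (N : ℕ) : Set (EuclideanSpace ℝ (Fin N)) := Metric.ball 0 1

/-- The hyperbolic Riemannian metric (constant curvature `-1`) of the ball model,
`g_x(v, w) = 4 ⟨v, w⟩ / (1 - |x|²)²`. -/
noncomputable def hypMetric {N : ℕ} (x v w : EuclideanSpace ℝ (Fin N)) : ℝ :=
  4 / (1 - ‖x‖ ^ 2) ^ 2 * inner ℝ v w

/-- The Riemannian volume measure `√(det g) dx = (2 / (1 - |x|²))^N dx` on the ball. -/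
noncomputable def hypVolume (N : ℕ) : Measure (EuclideanSpace ℝ (Fin N)) :=
  (volume.restrict (hypSpace N)).withDensity
    fun x => ENNReal.ofReal ((2 / (1 - ‖x‖ ^ 2)) ^ N)

/-- The Riemannian gradient: the vector field `∇u` with `g(∇u, w) = du(w)`
(see `hypMetric_hypGrad`). -/
noncomputable def hypGrad {N : ℕ} (u : EuclideanSpace ℝ (Fin N) → ℝ)
    (x : EuclideanSpace ℝ (Fin N)) : EuclideanSpace ℝ (Fin N) :=
  ((1 - ‖x‖ ^ 2) ^ 2 / 4) • gradient u x

theorem hypMetric_hypGrad {N : ℕ} (u : EuclideanSpace ℝ (Fin N) → ℝ)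
    {x : EuclideanSpace ℝ (Fin N)} (hx : x ∈ hypSpace N) (w : EuclideanSpace ℝ (Fin N)) :
    hypMetric x (hypGrad u x) w = fderiv ℝ u x w := by
  have h : ‖x‖ < 1 := by simpa [hypSpace] using hx
  have h1 : (1 - ‖x‖ ^ 2) ≠ 0 := by nlinarith [norm_nonneg x]
  have h2 : inner ℝ (gradient u x) w = fderiv ℝ u x w := by
    simp [gradient]
  rw [hypMetric, hypGrad, real_inner_smul_left, h2]
  field_simp

/-- The squared Riemannian length `|v|² = g_x(v, v)` of a tangent vector `v` at `x`. -/
noncomputable def hypNormSq {N : ℕ} (x v : EuclideanSpace ℝ (Fin N)) : ℝ := hypMetric x v v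

/-- The `C¹` curves `[0, 1] → ℍ^N` from `x` to `y`. -/
structure IsHypCurve {N : ℕ} (x y : EuclideanSpace ℝ (Fin N))
    (c : ℝ → EuclideanSpace ℝ (Fin N)) : Prop where
  contDiffOn : ContDiffOn ℝ 1 c (Icc 0 1)
  mapsTo : MapsTo c (Icc 0 1) (hypSpace N)
  source : c 0 = x
  target : c 1 = y

/-- The Riemannian length `∫₀¹ |c'(t)| dt` of a curve parametrised by `[0, 1]`. -/
noncomputable def hypLength {N : ℕ} (c : ℝ → EuclideanSpace ℝ (Fin N)) : ℝ :=
  ∫ t in (0 : ℝ)..1, √(hypNormSq (c t) (derivWithin c (Icc 0 1) t))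

/-- The geodesic (Riemannian) distance: the infimum of the lengths of the curves joining the two
points. -/
noncomputable def hypDist {N : ℕ} (x y : EuclideanSpace ℝ (Fin N)) : ℝ :=
  sInf {l | ∃ c, IsHypCurve x y c ∧ hypLength c = l}


theorem hyp_speed {N : ℕ} (x v : EuclideanSpace ℝ (Fin N)) (hx : x ∈ hypSpace N) :
    √(hypNormSq x v) = 2 * ‖v‖ / (1 - ‖x‖ ^ 2) := by
  have h : ‖x‖ < 1 := by simpa [hypSpace] using hx
  have h1 : 0 < 1 - ‖x‖ ^ 2 := by nlinarith [norm_nonneg x]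
  rw [Real.sqrt_eq_iff_mul_self_eq (by unfold hypNormSq hypMetric; rw [real_inner_self_eq_norm_sq]; positivity) (by positivity)]
  unfold hypNormSq hypMetric
  rw [real_inner_self_eq_norm_sq]
  field_simp
  ring

theorem hyp_deriv_bound {N : ℕ} (x z v : EuclideanSpace ℝ (Fin N)) (hx : ‖x‖ ^ 2 < 1)
    (hz : ‖z‖ ^ 2 < 1) :
    |(2 * inner ℝ (z - x) v * (1 - ‖z‖ ^ 2) + ‖z - x‖ ^ 2 * (2 * inner ℝ z v)) /
      ((1 - ‖x‖ ^ 2) * (1 - ‖z‖ ^ 2) ^ 2)| ≤ 2 * ‖v‖ / (1 - ‖z‖ ^ 2) *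
      √(‖z - x‖ ^ 2 / ((1 - ‖x‖ ^ 2) * (1 - ‖z‖ ^ 2)) *
        (1 + ‖z - x‖ ^ 2 / ((1 - ‖x‖ ^ 2) * (1 - ‖z‖ ^ 2)))) := by
  have ha : 0 < 1 - ‖x‖ ^ 2 := by linarith
  have hb : 0 < 1 - ‖z‖ ^ 2 := by linarith
  set w : EuclideanSpace ℝ (Fin N) := (1 - ‖z‖ ^ 2) • (z - x) + ‖z - x‖ ^ 2 • z with hw
  have h1 : 2 * inner ℝ (z - x) v * (1 - ‖z‖ ^ 2) + ‖z - x‖ ^ 2 * (2 * inner ℝ z v) =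
      2 * inner ℝ w v := by
    rw [hw, inner_add_left, real_inner_smul_left, real_inner_smul_left]; ring
  have h2 : ‖w‖ ^ 2 = ‖z - x‖ ^ 2 * ((1 - ‖x‖ ^ 2) * (1 - ‖z‖ ^ 2) + ‖z - x‖ ^ 2) := by
    have e1 : 2 * inner ℝ (z - x) z = ‖z - x‖ ^ 2 + ‖z‖ ^ 2 - ‖x‖ ^ 2 := by
      have := norm_sub_sq_real z (z - x)
      rw [sub_sub_cancel, real_inner_comm] at this
      linarith
    rw [hw, norm_add_sq_real, norm_smul, norm_smul, real_inner_smul_left, real_inner_smul_right,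
      Real.norm_of_nonneg hb.le, Real.norm_of_nonneg (sq_nonneg _)]
    linear_combination (1 - ‖z‖ ^ 2) * ‖z - x‖ ^ 2 * e1
  have h3 : ‖z - x‖ ^ 2 / ((1 - ‖x‖ ^ 2) * (1 - ‖z‖ ^ 2)) *
        (1 + ‖z - x‖ ^ 2 / ((1 - ‖x‖ ^ 2) * (1 - ‖z‖ ^ 2))) =
      (‖w‖ / ((1 - ‖x‖ ^ 2) * (1 - ‖z‖ ^ 2))) ^ 2 := by
    rw [div_pow, h2]; field_simp
  rw [h1, h3, Real.sqrt_sq (by positivity), abs_div, abs_of_pos (by positivity : 0 < (1 - ‖x‖ ^ 2) * (1 - ‖z‖ ^ 2) ^ 2),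
    abs_mul, abs_two]
  have := abs_real_inner_le_norm w v
  rw [div_mul_div_comm, div_le_div_iff₀ (by positivity) (by positivity)]
  have h4 : 0 ≤ (1 - ‖x‖ ^ 2) * (1 - ‖z‖ ^ 2) ^ 2 := by positivity
  nlinarith [mul_le_mul_of_nonneg_right this h4]

theorem IsHypCurve.norm_lt {N : ℕ} {x y : EuclideanSpace ℝ (Fin N)}
    {c : ℝ → EuclideanSpace ℝ (Fin N)} (hc : IsHypCurve x y c) {t : ℝ} (ht : t ∈ Icc (0:ℝ) 1) :
    ‖c t‖ ^ 2 < 1 := by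
  have h : ‖c t‖ < 1 := by simpa [hypSpace] using hc.mapsTo ht
  nlinarith [norm_nonneg (c t)]

theorem IsHypCurve.continuousOn_speed {N : ℕ} {x y : EuclideanSpace ℝ (Fin N)}
    {c : ℝ → EuclideanSpace ℝ (Fin N)} (hc : IsHypCurve x y c) :
    ContinuousOn (fun t => √(hypNormSq (c t) (derivWithin c (Icc 0 1) t))) (Icc 0 1) := by
  have h1 : ContinuousOn (derivWithin c (Icc 0 1)) (Icc 0 1) :=
    hc.contDiffOn.continuousOn_derivWithin (uniqueDiffOn_Icc zero_lt_one) le_rfl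
  have h2 := hc.contDiffOn.continuousOn
  refine ContinuousOn.congr (f := fun t => 2 * ‖derivWithin c (Icc 0 1) t‖ / (1 - ‖c t‖ ^ 2)) ?_
    fun t ht => hyp_speed _ _ (hc.mapsTo ht)
  refine (continuousOn_const.mul h1.norm).div (continuousOn_const.sub (h2.norm.pow 2)) ?_
  intro t ht
  have := hc.norm_lt ht
  linarith

theorem le_hypLength_aux {N : ℕ} {x y : EuclideanSpace ℝ (Fin N)}
    {c : ℝ → EuclideanSpace ℝ (Fin N)} (hc : IsHypCurve x y c) {ε : ℝ} (hε : 0 < ε) :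
    2 * Real.arsinh (√(‖y - x‖ ^ 2 / ((1 - ‖x‖ ^ 2) * (1 - ‖y‖ ^ 2)) + ε)) -
      2 * Real.arsinh √ε ≤ hypLength c := by
  have hx : ‖x‖ ^ 2 < 1 := by simpa [hc.source] using hc.norm_lt (t := 0) (by simp)
  have ha : 0 < 1 - ‖x‖ ^ 2 := by linarith
  set b : ℝ → ℝ := fun t => ‖c t - x‖ ^ 2 / ((1 - ‖x‖ ^ 2) * (1 - ‖c t‖ ^ 2)) with hb
  have hb0 : ∀ t ∈ Icc (0:ℝ) 1, 0 ≤ b t := fun t ht => by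
    have := hc.norm_lt ht
    have : 0 < 1 - ‖c t‖ ^ 2 := by linarith
    positivity
  set G : ℝ → ℝ := fun t => 2 * Real.arsinh √(b t + ε) with hG
  have hsp := hc.continuousOn_speed
  have hcb : ContinuousOn b (Icc 0 1) := by
    have h2 := hc.contDiffOn.continuousOn
    refine ((h2.sub continuousOn_const).norm.pow 2).div
      (continuousOn_const.mul (continuousOn_const.sub (h2.norm.pow 2))) fun t ht => ?_
    have := hc.norm_lt ht
    have : 0 < 1 - ‖c t‖ ^ 2 := by linarith
    positivity
  have hGc : ContinuousOn G (Icc 0 1) :=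
    continuousOn_const.mul (Real.continuous_arsinh.comp_continuousOn
      (Real.continuous_sqrt.comp_continuousOn (hcb.add continuousOn_const)))
  have hder : ∀ t ∈ Ioo (0:ℝ) 1, ∃ G', HasDerivAt G G' t ∧
      G' ≤ √(hypNormSq (c t) (derivWithin c (Icc 0 1) t)) := by
    intro t ht
    have htI := Ioo_subset_Icc_self ht
    have hct : HasDerivAt c (derivWithin c (Icc 0 1) t) t := by
      have h := (hc.contDiffOn.differentiableOn one_ne_zero t htI).hasDerivWithinAt
      exact h.hasDerivAt (Icc_mem_nhds ht.1 ht.2)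
    set v := derivWithin c (Icc 0 1) t
    have hz := hc.norm_lt htI
    have hz' : 0 < 1 - ‖c t‖ ^ 2 := by linarith
    have hbd : HasDerivAt b ((2 * inner ℝ (c t - x) v * (1 - ‖c t‖ ^ 2) + ‖c t - x‖ ^ 2 *
        (2 * inner ℝ (c t) v)) / ((1 - ‖x‖ ^ 2) * (1 - ‖c t‖ ^ 2) ^ 2)) t := by
      have h1 := (hct.sub_const x).norm_sq
      have h2 := (hct.norm_sq.const_sub 1).const_mul (1 - ‖x‖ ^ 2)
      have h3 := h1.div h2 (by positivity)
      refine h3.congr_deriv ?_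
      field_simp
      ring
    have hbt := hb0 t htI
    have hpos : 0 < b t + ε := by linarith
    have hGd := (((hbd.add_const ε).sqrt hpos.ne').arsinh).const_mul 2
    refine ⟨_, hGd, ?_⟩
    rw [hyp_speed _ _ (hc.mapsTo htI)]
    have hbound := (le_abs_self _).trans (hyp_deriv_bound x (c t) v hx hz)
    rw [Real.sq_sqrt hpos.le]
    have hS : 0 < √(1 + (b t + ε)) * √(b t + ε) := by positivity
    have hle : √(b t * (1 + b t)) ≤ √(1 + (b t + ε)) * √(b t + ε) := by
      rw [← Real.sqrt_mul (by linarith)]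
      apply Real.sqrt_le_sqrt
      nlinarith
    have hsn : 0 ≤ 2 * ‖v‖ / (1 - ‖c t‖ ^ 2) := by positivity
    have := hbound.trans (mul_le_mul_of_nonneg_left hle hsn)
    rw [smul_eq_mul]
    calc _ = ((2 * inner ℝ (c t - x) v * (1 - ‖c t‖ ^ 2) + ‖c t - x‖ ^ 2 *
        (2 * inner ℝ (c t) v)) / ((1 - ‖x‖ ^ 2) * (1 - ‖c t‖ ^ 2) ^ 2)) /
          (√(1 + (b t + ε)) * √(b t + ε)) := by field_simp
      _ ≤ _ := by rw [div_le_iff₀ hS]; exact this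
  choose! G' hG' hle using hder
  have key := intervalIntegral.sub_le_integral_of_hasDeriv_right_of_le (zero_le_one' ℝ) hGc
    (fun t ht => (hG' t ht).hasDerivWithinAt)
    (hsp.integrableOn_Icc) (fun t ht => hle t ht)
  simpa [hG, hb, hc.source, hc.target, hypLength] using key

theorem le_hypLength {N : ℕ} {x y : EuclideanSpace ℝ (Fin N)}
    {c : ℝ → EuclideanSpace ℝ (Fin N)} (hc : IsHypCurve x y c) :
    2 * Real.arsinh (‖x - y‖ / √((1 - ‖x‖ ^ 2) * (1 - ‖y‖ ^ 2))) ≤ hypLength c := by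
  set B := ‖y - x‖ ^ 2 / ((1 - ‖x‖ ^ 2) * (1 - ‖y‖ ^ 2)) with hB
  have hcont : Continuous fun ε : ℝ => 2 * Real.arsinh √(B + ε) - 2 * Real.arsinh √ε := by
    have := Real.continuous_arsinh
    fun_prop
  have hlim := (hcont.tendsto 0).mono_left (nhdsWithin_le_nhds (s := Ioi 0))
  have h := le_of_tendsto hlim (Filter.eventually_of_mem self_mem_nhdsWithin
    fun ε hε => le_hypLength_aux hc hε)
  have e : ‖x - y‖ / √((1 - ‖x‖ ^ 2) * (1 - ‖y‖ ^ 2)) = √B := by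
    rw [hB, Real.sqrt_div (sq_nonneg _), Real.sqrt_sq (norm_nonneg _), norm_sub_rev]
  rw [e]
  simpa using h

theorem hyp_geodesic_poly {N : ℕ} (x w : EuclideanSpace ℝ (Fin N)) (s : ℝ) :
    ‖(1 + 2 * inner ℝ x w * s + ‖w‖ ^ 2 * s ^ 2) • x + ((1 - ‖x‖ ^ 2) * s) • w‖ ^ 2 =
      (1 + 2 * inner ℝ x w * s + ‖x‖ ^ 2 * ‖w‖ ^ 2 * s ^ 2) ^ 2 -
      (1 - ‖x‖ ^ 2) * (1 - ‖w‖ ^ 2 * s ^ 2) *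
        (1 + 2 * inner ℝ x w * s + ‖x‖ ^ 2 * ‖w‖ ^ 2 * s ^ 2) := by
  rw [norm_add_sq_real, norm_smul, norm_smul, real_inner_smul_left, real_inner_smul_right,
    mul_pow, mul_pow, Real.norm_eq_abs, Real.norm_eq_abs, sq_abs, sq_abs]
  ring

theorem hyp_den_pos {N : ℕ} (x w : EuclideanSpace ℝ (Fin N)) (hx : ‖x‖ ^ 2 < 1)
    (hw : ‖w‖ ^ 2 < 1) {s : ℝ} (hs : s ∈ Icc (0:ℝ) 1) :
    0 < 1 + 2 * inner ℝ x w * s + ‖x‖ ^ 2 * ‖w‖ ^ 2 * s ^ 2 := by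
  have h1 := abs_real_inner_le_norm x w
  have h2 := neg_abs_le (inner ℝ x w)
  have hx1 : ‖x‖ < 1 := by nlinarith [norm_nonneg x]
  have hw1 : ‖w‖ < 1 := by nlinarith [norm_nonneg w]
  have h3 : ‖x‖ * ‖w‖ < 1 := by nlinarith [norm_nonneg x, norm_nonneg w]
  have h4 : 0 ≤ ‖x‖ * ‖w‖ := by positivity
  have h5 : ‖x‖ * ‖w‖ * s < 1 := by nlinarith [hs.1, hs.2]
  have h6 : -(‖x‖ * ‖w‖) * s ≤ inner ℝ x w * s :=
    mul_le_mul_of_nonneg_right (by linarith) hs.1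
  have h7 : 0 < (1 - ‖x‖ * ‖w‖ * s) ^ 2 := by
    have : 0 < 1 - ‖x‖ * ‖w‖ * s := by linarith
    positivity
  nlinarith

theorem exists_isHypCurve {N : ℕ} {x y : EuclideanSpace ℝ (Fin N)}
    (hx : x ∈ hypSpace N) (hy : y ∈ hypSpace N) :
    ∃ c, IsHypCurve x y c ∧
      hypLength c = 2 * Real.arsinh (‖x - y‖ / √((1 - ‖x‖ ^ 2) * (1 - ‖y‖ ^ 2))) := by
  have hx1 : ‖x‖ < 1 := by simpa [hypSpace] using hx
  have hy1 : ‖y‖ < 1 := by simpa [hypSpace] using hy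
  have hx2 : ‖x‖ ^ 2 < 1 := by nlinarith [norm_nonneg x]
  have hy2 : ‖y‖ ^ 2 < 1 := by nlinarith [norm_nonneg y]
  have ha : 0 < 1 - ‖x‖ ^ 2 := by linarith
  have hb : 0 < 1 - ‖y‖ ^ 2 := by linarith
  obtain ⟨d, rfl⟩ : ∃ d, y = x + d := ⟨y - x, by simp⟩
  have hyx : ‖x + d‖ ^ 2 = ‖x‖ ^ 2 + 2 * inner ℝ x d + ‖d‖ ^ 2 := norm_add_sq_real x d
  set P := (1 - ‖x‖ ^ 2) * (1 - ‖x + d‖ ^ 2) + ‖d‖ ^ 2 with hP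
  have hPpos : 0 < P := by positivity
  set w : EuclideanSpace ℝ (Fin N) := P⁻¹ • ((1 - ‖x‖ ^ 2) • d - ‖d‖ ^ 2 • x) with hw
  have hxw : inner ℝ x w = ((1 - ‖x‖ ^ 2) * inner ℝ x d - ‖d‖ ^ 2 * ‖x‖ ^ 2) / P := by
    rw [hw, real_inner_smul_right, inner_sub_right, real_inner_smul_right, real_inner_smul_right,
      real_inner_self_eq_norm_sq]
    field_simp
  have hww : ‖w‖ ^ 2 = ‖d‖ ^ 2 / P := by
    rw [hw, norm_smul, mul_pow, norm_sub_sq_real, norm_smul, norm_smul, real_inner_smul_left,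
      real_inner_smul_right, Real.norm_of_nonneg (inv_pos.2 hPpos).le, Real.norm_of_nonneg ha.le,
      Real.norm_of_nonneg (sq_nonneg _), real_inner_comm]
    field_simp
    rw [hP, hyx]
    ring
  clear_value w
  have hw2 : ‖w‖ ^ 2 < 1 := by
    rw [hww, div_lt_one hPpos, hP]
    have : 0 < (1 - ‖x‖ ^ 2) * (1 - ‖x + d‖ ^ 2) := by positivity
    linarith
  have hw1 : ‖w‖ < 1 := by nlinarith [norm_nonneg w]
  set den : ℝ → ℝ := fun s => 1 + 2 * inner ℝ x w * s + ‖x‖ ^ 2 * ‖w‖ ^ 2 * s ^ 2 with hden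
  set num : ℝ → EuclideanSpace ℝ (Fin N) := fun s =>
    (1 + 2 * inner ℝ x w * s + ‖w‖ ^ 2 * s ^ 2) • x + ((1 - ‖x‖ ^ 2) * s) • w with hnum
  have hdp : ∀ s ∈ Icc (0:ℝ) 1, 0 < den s := fun s hs => hyp_den_pos x w hx2 hw2 hs
  have hnd : ∀ s, ‖num s‖ ^ 2 =
      den s ^ 2 - (1 - ‖x‖ ^ 2) * (1 - ‖w‖ ^ 2 * s ^ 2) * den s := fun s =>
    hyp_geodesic_poly x w s
  have hsw : ∀ s ∈ Icc (0:ℝ) 1, 0 < 1 - ‖w‖ ^ 2 * s ^ 2 := fun s hs => by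
    have : s ^ 2 ≤ 1 := by nlinarith [hs.1, hs.2]
    nlinarith [sq_nonneg ‖w‖]
  have hcn : ∀ s ∈ Icc (0:ℝ) 1, 1 - ‖(den s)⁻¹ • num s‖ ^ 2 =
      (1 - ‖x‖ ^ 2) * (1 - ‖w‖ ^ 2 * s ^ 2) / den s := fun s hs => by
    have := hdp s hs
    rw [norm_smul, mul_pow, hnd, Real.norm_of_nonneg (inv_pos.2 this).le]
    field_simp
    ring
  have hcurve : IsHypCurve x (x + d) (fun s => (den s)⁻¹ • num s) := by
    refine ⟨?_, ?_, ?_, ?_⟩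
    · refine ContDiffOn.smul (ContDiffOn.inv ?_ fun s hs => (hdp s hs).ne') ?_
      · exact ContDiff.contDiffOn (by fun_prop)
      · exact ContDiff.contDiffOn (by fun_prop)
    · intro s hs
      have h1 := hcn s hs
      have h2 := hsw s hs
      have h3 := hdp s hs
      have h4 : 0 < (1 - ‖x‖ ^ 2) * (1 - ‖w‖ ^ 2 * s ^ 2) / den s := by positivity
      have h5 : ‖(den s)⁻¹ • num s‖ < 1 := by
        nlinarith [norm_nonneg ((den s)⁻¹ • num s)]
      simpa [hypSpace] using h5
    · simp [hden, hnum]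
    · have e1 : den 1 = (1 - ‖x‖ ^ 2) ^ 2 / P := by
        simp only [hden, hxw, hww]
        field_simp
        rw [hP, hyx]
        ring
      have e2 : 1 + 2 * inner ℝ x w + ‖w‖ ^ 2 = (1 - ‖x‖ ^ 2) * (1 - ‖x‖ ^ 2 + ‖d‖ ^ 2) / P := by
        rw [hxw, hww]
        field_simp
        rw [hP, hyx]
        ring
      have e3 : num 1 = ((1 - ‖x‖ ^ 2) ^ 2 / P) • (x + d) := by
        simp only [hnum, mul_one, one_pow, e2]
        rw [hw]
        match_scalars
        · field_simp
          ring
        · field_simp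
      simp only [e1, e3]
      rw [smul_smul, inv_mul_cancel₀ (by positivity), one_smul]
  refine ⟨_, hcurve, ?_⟩
  have hspeed : ∀ s ∈ Ioo (0:ℝ) 1,
      √(hypNormSq ((den s)⁻¹ • num s) (derivWithin (fun s => (den s)⁻¹ • num s) (Icc 0 1) s)) =
        2 * ‖w‖ / (1 - ‖w‖ ^ 2 * s ^ 2) := by
    intro s hs
    have hsI := Ioo_subset_Icc_self hs
    have hdpos := hdp s hsI
    have hsw' := hsw s hsI
    rw [hyp_speed _ _ (hcurve.mapsTo hsI), hcn s hsI,
      derivWithin_of_mem_nhds (Icc_mem_nhds hs.1 hs.2)]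
    have hd1 : HasDerivAt den (2 * inner ℝ x w + ‖x‖ ^ 2 * ‖w‖ ^ 2 * (2 * s)) s := by
      have h1 := ((hasDerivAt_id s).const_mul (2 * inner ℝ x w)).const_add 1
      have h2 := ((hasDerivAt_id s).pow 2).const_mul (‖x‖ ^ 2 * ‖w‖ ^ 2)
      exact (h1.add h2).congr_deriv (by simp)
    have hn1 : HasDerivAt num ((2 * inner ℝ x w + ‖w‖ ^ 2 * (2 * s)) • x + (1 - ‖x‖ ^ 2) • w) s := by
      have h1 := ((hasDerivAt_id s).const_mul (2 * inner ℝ x w)).const_add 1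
      have h2 := ((hasDerivAt_id s).pow 2).const_mul (‖w‖ ^ 2)
      have h3 := ((h1.add h2).smul_const x).add
        (((hasDerivAt_id s).const_mul (1 - ‖x‖ ^ 2)).smul_const w)
      exact h3.congr_deriv (by simp)
    have hq := ((hd1.inv hdpos.ne').smul hn1).deriv
    have hq' : deriv (fun s => (den s)⁻¹ • num s) s = ((1 - ‖x‖ ^ 2) / den s ^ 2) •
        ((2 * ‖w‖ ^ 2 * s * (1 + inner ℝ x w * s)) • x +
          (1 - ‖x‖ ^ 2 * ‖w‖ ^ 2 * s ^ 2) • w) := by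
      refine Eq.trans hq ?_
      simp only [hnum]
      match_scalars
      · have := hdpos.ne'
        simp only [Pi.inv_apply]
        field_simp
        simp only [hden]
        ring
      · have := hdpos.ne'
        simp only [Pi.inv_apply]
        field_simp
        simp only [hden]
        ring
    have hv : ‖(2 * ‖w‖ ^ 2 * s * (1 + inner ℝ x w * s)) • x +
          (1 - ‖x‖ ^ 2 * ‖w‖ ^ 2 * s ^ 2) • w‖ = ‖w‖ * den s := by
      rw [← sq_eq_sq₀ (norm_nonneg _) (by positivity), norm_add_sq_real, norm_smul, norm_smul,
        real_inner_smul_left, real_inner_smul_right,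
        mul_pow, mul_pow, Real.norm_eq_abs, Real.norm_eq_abs, sq_abs, sq_abs]
      simp only [hden]
      ring
    rw [hq', norm_smul, hv, Real.norm_of_nonneg (by positivity)]
    field_simp
  have hlen : hypLength (fun s => (den s)⁻¹ • num s) = 2 * Real.artanh ‖w‖ := by
    have hF : ∀ s ∈ Icc (0:ℝ) 1, HasDerivAt (fun s =>
        Real.log (1 + s * ‖w‖) - Real.log (1 - s * ‖w‖)) (2 * ‖w‖ / (1 - ‖w‖ ^ 2 * s ^ 2)) s := by
      intro s hs
      have hs1 : s * ‖w‖ < 1 := by nlinarith [hs.1, hs.2, norm_nonneg w]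
      have hs0 : 0 ≤ s * ‖w‖ := mul_nonneg hs.1 (norm_nonneg w)
      have h1 := (((hasDerivAt_id s).mul_const ‖w‖).const_add 1).log (by simp; linarith)
      have h2 := (((hasDerivAt_id s).mul_const ‖w‖).const_sub 1).log (by simp; linarith)
      refine (h1.sub h2).congr_deriv ?_
      have e1 : 1 + s * ‖w‖ ≠ 0 := by linarith
      have e2 : 1 - s * ‖w‖ ≠ 0 := by linarith
      have e3 : 1 - ‖w‖ ^ 2 * s ^ 2 = (1 + s * ‖w‖) * (1 - s * ‖w‖) := by ring
      simp only [id]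
      rw [e3, div_sub_div _ _ e1 e2]
      congr 1
      ring
    have hint : hypLength (fun s => (den s)⁻¹ • num s) =
        ∫ s in (0:ℝ)..1, 2 * ‖w‖ / (1 - ‖w‖ ^ 2 * s ^ 2) := by
      unfold hypLength
      rw [intervalIntegral.integral_of_le zero_le_one, intervalIntegral.integral_of_le zero_le_one,
        integral_Ioc_eq_integral_Ioo, integral_Ioc_eq_integral_Ioo]
      exact setIntegral_congr_fun measurableSet_Ioo hspeed
    rw [hint, intervalIntegral.integral_eq_sub_of_hasDerivAt
      (f := fun s => Real.log (1 + s * ‖w‖) - Real.log (1 - s * ‖w‖))]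
    · have hn := norm_nonneg w
      rw [Real.artanh_eq_half_log ⟨by linarith, hw1.le⟩, Real.log_div (by linarith) (by linarith)]
      simp
    · intro s hs
      rw [uIcc_of_le zero_le_one] at hs
      exact hF s hs
    · apply ContinuousOn.intervalIntegrable
      rw [uIcc_of_le zero_le_one]
      refine continuousOn_const.div (by fun_prop) fun s hs => (hsw s hs).ne'
  rw [hlen, ← Real.arsinh_sinh (Real.artanh ‖w‖), Real.sinh_artanh ⟨by linarith [norm_nonneg w], hw1⟩]
  congr 2
  have hxd : ‖x - (x + d)‖ = ‖d‖ := by simp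
  rw [hxd]
  have h1 : 1 - ‖w‖ ^ 2 = (1 - ‖x‖ ^ 2) * (1 - ‖x + d‖ ^ 2) / P := by
    rw [hww, eq_div_iff hPpos.ne', sub_mul, div_mul_cancel₀ _ hPpos.ne', hP]
    ring
  have hwn : ‖w‖ = ‖d‖ / √P := by
    rw [← Real.sqrt_sq (norm_nonneg w), hww, Real.sqrt_div (sq_nonneg _),
      Real.sqrt_sq (norm_nonneg _)]
  rw [h1, Real.sqrt_div (by positivity), hwn]
  have : √P ≠ 0 := by positivity
  have : √((1 - ‖x‖ ^ 2) * (1 - ‖x + d‖ ^ 2)) ≠ 0 := by positivity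
  field_simp

/-- The infimum defining the geodesic distance is attained, with the usual closed form. -/
theorem hypDist_eq {N : ℕ} {x y : EuclideanSpace ℝ (Fin N)}
    (hx : x ∈ hypSpace N) (hy : y ∈ hypSpace N) :
    hypDist x y = 2 * Real.arsinh (‖x - y‖ / √((1 - ‖x‖ ^ 2) * (1 - ‖y‖ ^ 2))) := by
  refine IsLeast.csInf_eq ⟨exists_isHypCurve hx hy, ?_⟩
  rintro l ⟨c, hc, rfl⟩
  exact le_hypLength hc

/-- The radial part of the gradient with respect to the pole `x₀`. In geodesic polar coordinates
`(r, Θ)` around `x₀` the coordinate field `∂/∂r` is the unit field `∇r`, with `r = d(x₀, ·)`, so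
`∇_r u = (∂u/∂r, 0)` is `g(∇u, ∇r) ∇r`. -/
noncomputable def hypRadialGrad {N : ℕ} (x₀ : EuclideanSpace ℝ (Fin N))
    (u : EuclideanSpace ℝ (Fin N) → ℝ) (x : EuclideanSpace ℝ (Fin N)) :
    EuclideanSpace ℝ (Fin N) :=
  hypMetric x (hypGrad u x) (hypGrad (hypDist x₀) x) • hypGrad (hypDist x₀) x

/-- The space `C_c^∞(ℍ^N ∖ {x₀})`, its elements being extended by zero outside the ball. -/
structure IsHypTestFunction {N : ℕ} (x₀ : EuclideanSpace ℝ (Fin N))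
    (u : EuclideanSpace ℝ (Fin N) → ℝ) : Prop where
  contDiff : ContDiff ℝ ∞ u
  hasCompactSupport : HasCompactSupport u
  tsupport_subset : tsupport u ⊆ hypSpace N \ {x₀}

/-- `γ_N(λ) = √((N - 1)² - 4λ)`. -/
noncomputable def gammaN (N : ℕ) (lam : ℝ) : ℝ := √(((N : ℝ) - 1) ^ 2 - 4 * lam)

/-- `h_N(λ) = (γ_N(λ) + 1) / 2`. -/
noncomputable def hN (N : ℕ) (lam : ℝ) : ℝ := (gammaN N lam + 1) / 2

/-- `Ψ_λ(r) = r^{-(N-2)/2} (sinh r / r)^{-(N-1+γ_N(λ))/2}`, for `r > 0`. -/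
noncomputable def PsiN (N : ℕ) (lam r : ℝ) : ℝ :=
  r ^ (-(((N : ℝ) - 2) / 2)) * (Real.sinh r / r) ^ (-(((N : ℝ) - 1 + gammaN N lam) / 2))

/-- The weight `(r coth r - 1) / r²`, for `r > 0`. -/
noncomputable def cothWeight (r : ℝ) : ℝ :=
  (r * (Real.cosh r / Real.sinh r) - 1) / r ^ 2

/-! This is a ground state substitution. Let ψ > 0 be a function of r with ψ' = ηψ. Since |∇r| = 1,
expanding the square gives ψ²|∇(u/ψ)|² = |∇u|² − 2uη ∂_r u + u²η², and likewise for ∇_r, so both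
identities share one cross term. As Δr = (N−1) coth r off the pole, integrating the divergence of
u²η∇r replaces 2uη ∂_r u by −u²(η' + (N−1) coth r · η). Hence the energy is ∫ V u² plus the
remainder, with V = −(η' + (N−1) coth r · η + η²) = −Δψ/ψ; this is
`IsHypTestFunction.integral_hypGrad_eq`. What remains is to compute V for Ψ_λ (`potentialN_eq`).

Polar coordinates are avoided. In the ball model cosh r is a rational expression, smooth even at the
pole, and Δ cosh r = N cosh r follows from an explicit Euclidean divergence
(`divergence_hypCoshField`, `integral_mul_hypCosh`). Because ∇cosh r = sinh r ∇r, testing this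
equation against u²η/sinh r gives the cross term formula (`IsHypTestFunction.integral_cross`).
Compact support away from the pole makes every integral finite and removes boundary terms. -/

/-! ### Euclidean integration by parts with compact support. -/

theorem integrable_of_continuousOn_of_eq_zero {X : Type*} [TopologicalSpace X] [T2Space X]
    [MeasurableSpace X] [OpensMeasurableSpace X] {μ : Measure X} [IsFiniteMeasureOnCompacts μ]
    {F : X → ℝ} {K : Set X} (hK : IsCompact K) (hF : ContinuousOn F K)
    (h0 : ∀ x ∉ K, F x = 0) : Integrable F μ := by
  rw [← integrableOn_iff_integrable_of_support_subset (s := K)]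
  · exact hF.integrableOn_compact hK
  · intro x hx
    by_contra h
    exact hx (h0 x h)

theorem clm_apply_eq_sum {N : ℕ} (L : EuclideanSpace ℝ (Fin N) →L[ℝ] ℝ)
    (y : EuclideanSpace ℝ (Fin N)) :
    L y = ∑ i, L (EuclideanSpace.single i 1) * y i := by
  have hs : y = ∑ i, (y i) • EuclideanSpace.single i (1 : ℝ) := by
    have := (EuclideanSpace.basisFun (Fin N) ℝ).sum_repr y
    simpa using this.symm
  conv_lhs => rw [hs, map_sum]
  exact Finset.sum_congr rfl fun i _ => by rw [map_smul, smul_eq_mul, mul_comm]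

/-- Integration by parts against the divergence of a vector field. -/
theorem integral_mul_divergence {N : ℕ} {f : EuclideanSpace ℝ (Fin N) → ℝ}
    {Y : EuclideanSpace ℝ (Fin N) → EuclideanSpace ℝ (Fin N)} {V : Set (EuclideanSpace ℝ (Fin N))}
    (hV : IsOpen V) (hf : ContDiff ℝ 1 f) (hfc : HasCompactSupport f) (hfV : tsupport f ⊆ V)
    (hY : ContDiffOn ℝ 1 Y V) :
    ∫ x, f x * ∑ i, (fderiv ℝ Y x (EuclideanSpace.single i 1)) i =
      -∫ x, fderiv ℝ f x (Y x) := by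
  have hYi : ∀ i, ContDiffOn ℝ 1 (fun x => Y x i) V := fun i => by
    have := contDiffOn_euclidean.1 hY i
    exact this
  have hdY : ∀ x ∈ V, DifferentiableAt ℝ Y x := fun x hx =>
    (hY.differentiableOn one_ne_zero).differentiableAt (hV.mem_nhds hx)
  have hdYi : ∀ i, ∀ x ∈ V, DifferentiableAt ℝ (fun x => Y x i) x := fun i x hx =>
    ((hYi i).differentiableOn one_ne_zero).differentiableAt (hV.mem_nhds hx)
  have hfY : ∀ x ∈ V, ∀ i v, fderiv ℝ (fun x => Y x i) x v = (fderiv ℝ Y x v) i := by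
    intro x hx i v
    have h := ((EuclideanSpace.proj (𝕜 := ℝ) i).hasFDerivAt (x := Y x)).comp x (hdY x hx).hasFDerivAt
    have h2 := h.fderiv
    have h3 : (EuclideanSpace.proj (𝕜 := ℝ) i) ∘ Y = fun x => Y x i := rfl
    rw [h3] at h2
    rw [h2]
    rfl
  have hf0 : ∀ x ∉ tsupport f, f x = 0 := fun x hx => image_eq_zero_of_notMem_tsupport hx
  have hdf0 : ∀ x ∉ tsupport f, fderiv ℝ f x = 0 := fun x hx =>
    image_eq_zero_of_notMem_tsupport fun h => hx (tsupport_fderiv_subset ℝ h)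
  have hcf : ContinuousOn f (tsupport f) := hf.continuous.continuousOn
  have hcdf : ∀ v, ContinuousOn (fun x => fderiv ℝ f x v) (tsupport f) := fun v =>
    ((hf.continuous_fderiv one_ne_zero).clm_apply continuous_const).continuousOn
  have hcYi : ∀ i, ContinuousOn (fun x => Y x i) (tsupport f) := fun i =>
    (hYi i).continuousOn.mono hfV
  have hcdYi : ∀ i v, ContinuousOn (fun x => fderiv ℝ (fun x => Y x i) x v) (tsupport f) :=
    fun i v => (((hYi i).continuousOn_fderiv_of_isOpen hV le_rfl).mono hfV).clm_apply
      continuousOn_const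
  have hi1 : ∀ i v, Integrable (fun x => fderiv ℝ f x v * Y x i) := fun i v =>
    integrable_of_continuousOn_of_eq_zero hfc ((hcdf v).mul (hcYi i)) fun x hx => by
      simp [hdf0 x hx]
  have hi2 : ∀ i v, Integrable (fun x => f x * fderiv ℝ (fun x => Y x i) x v) := fun i v =>
    integrable_of_continuousOn_of_eq_zero hfc (hcf.mul (hcdYi i v)) fun x hx => by
      simp [hf0 x hx]
  have hi3 : ∀ i, Integrable (fun x => f x * Y x i) := fun i =>
    integrable_of_continuousOn_of_eq_zero hfc (hcf.mul (hcYi i)) fun x hx => by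
      simp [hf0 x hx]
  -- Differentiability of `Y` is needed only on the support of `f`, so its behaviour outside `V` is
  -- irrelevant.
  have key : ∀ i v, ∫ x, f x * fderiv ℝ (fun x => Y x i) x v = -∫ x, fderiv ℝ f x v * Y x i :=
    fun i v => integral_mul_fderiv_eq_neg_fderiv_mul_of_integrable (hi1 i v) (hi2 i v) (hi3 i)
      (fun x _ => (hf.differentiable one_ne_zero) x) (fun x hx => hdYi i x (hfV hx))
  calc _ = ∫ x, ∑ i, f x * fderiv ℝ (fun x => Y x i) x (EuclideanSpace.single i 1) := by
        congr 1 with x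
        by_cases hx : x ∈ tsupport f
        · simp [hfY x (hfV hx), Finset.mul_sum]
        · simp [hf0 x hx]
    _ = -∫ x, ∑ i, fderiv ℝ f x (EuclideanSpace.single i 1) * Y x i := by
        rw [integral_finsetSum _ fun i _ => hi2 i _, integral_finsetSum _ fun i _ => hi1 i _,
          ← Finset.sum_neg_distrib]
        exact Finset.sum_congr rfl fun i _ => key i _
    _ = _ := by
        congr 2 with x
        exact (clm_apply_eq_sum _ _).symm

/-! ### The function cosh r and its Laplacian. -/

theorem isOpen_hypSpace (N : ℕ) : IsOpen (hypSpace N) := Metric.isOpen_ball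

theorem one_sub_norm_sq_pos {N : ℕ} {x : EuclideanSpace ℝ (Fin N)} (hx : x ∈ hypSpace N) :
    0 < 1 - ‖x‖ ^ 2 := by
  have h : ‖x‖ < 1 := by simpa [hypSpace] using hx
  nlinarith [norm_nonneg x]

/-- The closed form of `cosh d(x₀, x)` in the ball model. -/
noncomputable def hypCosh {N : ℕ} (x₀ x : EuclideanSpace ℝ (Fin N)) : ℝ :=
  1 + 2 * ‖x₀ - x‖ ^ 2 / ((1 - ‖x₀‖ ^ 2) * (1 - ‖x‖ ^ 2))

/-- The doubling formula cosh 2a = 1 + 2 sinh² a removes both the arsinh and the square root from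
the closed form of the distance. -/
theorem cosh_hypDist {N : ℕ} {x₀ x : EuclideanSpace ℝ (Fin N)} (hx₀ : x₀ ∈ hypSpace N)
    (hx : x ∈ hypSpace N) : Real.cosh (hypDist x₀ x) = hypCosh x₀ x := by
  have h0 := one_sub_norm_sq_pos hx₀
  have h1 := one_sub_norm_sq_pos hx
  rw [hypDist_eq hx₀ hx, Real.cosh_two_mul, Real.cosh_sq, Real.sinh_arsinh, div_pow,
    Real.sq_sqrt (by positivity), hypCosh]
  ring

theorem hypDist_pos {N : ℕ} {x₀ x : EuclideanSpace ℝ (Fin N)} (hx₀ : x₀ ∈ hypSpace N)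
    (hx : x ∈ hypSpace N) (hne : x ≠ x₀) : 0 < hypDist x₀ x := by
  have h0 := one_sub_norm_sq_pos hx₀
  have h1 := one_sub_norm_sq_pos hx
  have h2 : 0 < ‖x₀ - x‖ := norm_pos_iff.2 (sub_ne_zero.2 hne.symm)
  rw [hypDist_eq hx₀ hx]
  have : 0 < Real.arsinh (‖x₀ - x‖ / √((1 - ‖x₀‖ ^ 2) * (1 - ‖x‖ ^ 2))) :=
    Real.arsinh_pos_iff.2 (by positivity)
  linarith

theorem contDiffOn_hypDist {N : ℕ} {x₀ : EuclideanSpace ℝ (Fin N)} (hx₀ : x₀ ∈ hypSpace N) :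
    ContDiffOn ℝ ∞ (hypDist x₀) (hypSpace N \ {x₀}) := by
  have h0 := one_sub_norm_sq_pos hx₀
  have h : ContDiffOn ℝ ∞ (fun x => 2 * Real.arsinh
      (‖x₀ - x‖ / √((1 - ‖x₀‖ ^ 2) * (1 - ‖x‖ ^ 2)))) (hypSpace N \ {x₀}) := by
    refine contDiffOn_const.mul (Real.contDiff_arsinh.comp_contDiffOn ?_)
    have hpos : ∀ x ∈ hypSpace N \ {x₀}, 0 < (1 - ‖x₀‖ ^ 2) * (1 - ‖x‖ ^ 2) := fun x hx => by
      have := one_sub_norm_sq_pos hx.1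
      positivity
    refine ContDiffOn.div ?_ ?_ fun x hx => (Real.sqrt_pos.2 (hpos x hx)).ne'
    · exact ContDiffOn.norm ℝ (by fun_prop) fun x hx => sub_ne_zero.2 (Ne.symm hx.2)
    · refine ContDiffOn.sqrt ?_ fun x hx => (hpos x hx).ne'
      exact contDiffOn_const.mul (contDiffOn_const.sub (contDiff_norm_sq ℝ).contDiffOn)
  exact h.congr fun x hx => hypDist_eq hx₀ hx.1

/-- The Euclidean gradient of `hypCosh x₀`. -/
noncomputable def hypCoshGrad {N : ℕ} (x₀ x : EuclideanSpace ℝ (Fin N)) :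
    EuclideanSpace ℝ (Fin N) :=
  (4 / ((1 - ‖x₀‖ ^ 2) * (1 - ‖x‖ ^ 2) ^ 2)) •
    ((1 + ‖x₀‖ ^ 2 - 2 * inner ℝ x₀ x) • x - (1 - ‖x‖ ^ 2) • x₀)

theorem hasFDerivAt_hypCosh {N : ℕ} {x₀ x : EuclideanSpace ℝ (Fin N)} (hx₀ : x₀ ∈ hypSpace N)
    (hx : x ∈ hypSpace N) : HasFDerivAt (hypCosh x₀) (innerSL ℝ (hypCoshGrad x₀ x)) x := by
  have h0 := one_sub_norm_sq_pos hx₀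
  have h1 := one_sub_norm_sq_pos hx
  have hn := ((hasFDerivAt_id x).const_sub x₀).norm_sq.const_mul 2
  have hd := ((hasFDerivAt_id x).norm_sq.const_sub 1).const_mul (1 - ‖x₀‖ ^ 2)
  have hi := (hasDerivAt_inv (x := (1 - ‖x₀‖ ^ 2) * (1 - ‖id x‖ ^ 2))
    (by simp only [id]; positivity)).comp_hasFDerivAt x hd
  have h := (hn.mul hi).const_add 1
  refine HasFDerivAt.congr_fderiv h ?_
  ext v
  have e := norm_sub_sq_real x₀ x
  simp only [hypCoshGrad, innerSL_apply_apply, real_inner_smul_left, inner_sub_left, id,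
    smul_apply, sub_apply, ContinuousLinearMap.comp_apply, neg_apply, ContinuousLinearMap.id_apply,
    smul_eq_mul, nsmul_eq_mul, add_apply, Function.comp_apply, map_sub, map_neg, e]
  field_simp
  push_cast
  ring

/-- This is |∇cosh r|² = sinh² r in Euclidean terms, the source of the eikonal equation |∇r| = 1. -/
theorem norm_sq_hypCoshGrad {N : ℕ} {x₀ x : EuclideanSpace ℝ (Fin N)} (hx₀ : x₀ ∈ hypSpace N)
    (hx : x ∈ hypSpace N) :
    ‖hypCoshGrad x₀ x‖ ^ 2 = 4 / (1 - ‖x‖ ^ 2) ^ 2 * (hypCosh x₀ x ^ 2 - 1) := by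
  have h0 := one_sub_norm_sq_pos hx₀
  have h1 := one_sub_norm_sq_pos hx
  rw [hypCoshGrad, hypCosh, norm_smul, mul_pow, norm_sub_sq_real, norm_smul, norm_smul,
    real_inner_smul_left, real_inner_smul_right, mul_pow, mul_pow, Real.norm_eq_abs,
    Real.norm_eq_abs, Real.norm_eq_abs, sq_abs, sq_abs, sq_abs, norm_sub_sq_real,
    real_inner_comm x x₀]
  field_simp
  ring

/-- The vector field `√g g⁻¹ d(cosh d(x₀, ·))`, whose Euclidean divergence is `√g Δ cosh d`. -/
noncomputable def hypCoshField {N : ℕ} (x₀ x : EuclideanSpace ℝ (Fin N)) :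
    EuclideanSpace ℝ (Fin N) :=
  (2 ^ N / (1 - ‖x₀‖ ^ 2)) • (((1 - ‖x‖ ^ 2)⁻¹ ^ N * (1 + ‖x₀‖ ^ 2 - 2 * inner ℝ x₀ x)) • x -
    ((1 - ‖x‖ ^ 2)⁻¹ ^ N * (1 - ‖x‖ ^ 2)) • x₀)

/-- Links the geometric form of the field (√g times the inverse conformal factor) with the form αx −
βx₀ of its definition, which suits the product rule and needs no case distinction on N against the
power (1 − |x|²)². -/
theorem hypCoshField_eq {N : ℕ} {x₀ x : EuclideanSpace ℝ (Fin N)} (hx₀ : x₀ ∈ hypSpace N)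
    (hx : x ∈ hypSpace N) : hypCoshField x₀ x =
      ((2 / (1 - ‖x‖ ^ 2)) ^ N * ((1 - ‖x‖ ^ 2) ^ 2 / 4)) • hypCoshGrad x₀ x := by
  have h0 := one_sub_norm_sq_pos hx₀
  have h1 := one_sub_norm_sq_pos hx
  rw [hypCoshField, hypCoshGrad, smul_smul, div_pow, inv_pow]
  match_scalars
  · field_simp
  · field_simp

theorem contDiffOn_hypCoshField {N : ℕ} (x₀ : EuclideanSpace ℝ (Fin N)) :
    ContDiffOn ℝ 1 (hypCoshField x₀) (hypSpace N) := by
  have hs : ContDiffOn ℝ 1 (fun x : EuclideanSpace ℝ (Fin N) => 1 - ‖x‖ ^ 2) (hypSpace N) :=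
    contDiffOn_const.sub (contDiff_norm_sq ℝ).contDiffOn
  have hi := (hs.inv fun x hx => (one_sub_norm_sq_pos hx).ne').pow N
  have hp : ContDiffOn ℝ 1 (fun x : EuclideanSpace ℝ (Fin N) => 1 + ‖x₀‖ ^ 2 - 2 * inner ℝ x₀ x)
      (hypSpace N) := (contDiff_const.sub (contDiff_const.mul
        (innerSL ℝ x₀).contDiff)).contDiffOn
  exact (contDiffOn_const (c := (2 ^ N / (1 - ‖x₀‖ ^ 2) : ℝ))).smul
    (((hi.mul hp).smul contDiffOn_id).sub
      ((hi.mul hs).smul (contDiffOn_const (c := x₀))))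

theorem divergence_hypCoshField {N : ℕ} {x₀ x : EuclideanSpace ℝ (Fin N)} (hx₀ : x₀ ∈ hypSpace N)
    (hx : x ∈ hypSpace N) :
    ∑ i, (fderiv ℝ (hypCoshField x₀) x (EuclideanSpace.single i 1)) i =
      (2 / (1 - ‖x‖ ^ 2)) ^ N * (N * hypCosh x₀ x) := by
  have h0 := one_sub_norm_sq_pos hx₀
  have h1 := one_sub_norm_sq_pos hx
  have hs : HasFDerivAt (fun x : EuclideanSpace ℝ (Fin N) => 1 - ‖x‖ ^ 2)
      ((-2 : ℝ) • innerSL ℝ x) x := by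
    refine ((hasStrictFDerivAt_norm_sq x).hasFDerivAt.const_sub 1).congr_fderiv ?_
    ext v
    simp
  have hτ : HasFDerivAt (fun x : EuclideanSpace ℝ (Fin N) => (1 - ‖x‖ ^ 2)⁻¹ ^ N)
      ((2 * (N : ℝ) * (1 - ‖x‖ ^ 2)⁻¹ ^ N * (1 - ‖x‖ ^ 2)⁻¹) • innerSL ℝ x) x := by
    have := (((hasDerivAt_inv h1.ne').fun_pow N).comp_hasFDerivAt x hs)
    refine this.congr_fderiv ?_
    ext v
    -- The power rule produces the truncated exponent N − 1, hence the separate case N = 0.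
    rcases N with _ | M
    · simp
    · simp only [smul_apply, smul_eq_mul, Nat.add_sub_cancel, inv_pow]
      push_cast
      field_simp
      ring
  have hp : HasFDerivAt (fun x : EuclideanSpace ℝ (Fin N) => 1 + ‖x₀‖ ^ 2 - 2 * inner ℝ x₀ x)
      ((-2 : ℝ) • innerSL ℝ x₀) x := by
    refine (((innerSL ℝ x₀).hasFDerivAt.const_mul 2).const_sub (1 + ‖x₀‖ ^ 2)).congr_fderiv ?_
    ext v
    simp
  have hα := hτ.mul hp
  have hβ := hτ.mul hs
  have hZ := ((hα.smul (hasFDerivAt_id x)).sub (hβ.smul_const x₀)).const_smul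
    (2 ^ N / (1 - ‖x₀‖ ^ 2))
  have hZ' : fderiv ℝ (hypCoshField x₀) x = _ := HasFDerivAt.fderiv hZ
  rw [hZ']
  -- The divergence is a trace: the identity contributes N, and a rank-one map `A.smulRight x`
  -- contributes `A x`.
  have e : ∀ (c d : ℝ) (A B : EuclideanSpace ℝ (Fin N) →L[ℝ] ℝ),
      ∑ i, ((c • (d • ContinuousLinearMap.id ℝ (EuclideanSpace ℝ (Fin N)) +
        A.smulRight x - B.smulRight x₀)) (EuclideanSpace.single i 1)) i =
      c * (N * d + A x - B x₀) := by
    intro c d A B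
    rw [clm_apply_eq_sum A, clm_apply_eq_sum B]
    simp [Finset.mul_sum, Finset.sum_add_distrib, mul_add, mul_sub]
    ring
  refine (e _ _ _ _).trans ?_
  have en := norm_sub_sq_real x₀ x
  simp only [hypCosh, en, Pi.mul_apply, add_apply, smul_apply, innerSL_apply_apply, smul_eq_mul,
    real_inner_self_eq_norm_sq, real_inner_comm x x₀, div_pow, inv_pow]
  field_simp
  ring

/-- The weak form of `Δ cosh d(x₀, ·) = N cosh d(x₀, ·)`. -/
theorem integral_mul_hypCosh {N : ℕ} {x₀ : EuclideanSpace ℝ (Fin N)} (hx₀ : x₀ ∈ hypSpace N)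
    {f : EuclideanSpace ℝ (Fin N) → ℝ} (hf : ContDiff ℝ 1 f) (hfc : HasCompactSupport f)
    (hfV : tsupport f ⊆ hypSpace N) :
    ∫ x, (2 / (1 - ‖x‖ ^ 2)) ^ N * (N * hypCosh x₀ x * f x) =
      -∫ x, (2 / (1 - ‖x‖ ^ 2)) ^ N * ((1 - ‖x‖ ^ 2) ^ 2 / 4 * fderiv ℝ f x (hypCoshGrad x₀ x)) := by
  have h := integral_mul_divergence (isOpen_hypSpace N) hf hfc hfV (contDiffOn_hypCoshField x₀)
  have hf0 : ∀ x ∉ tsupport f, f x = 0 := fun x hx => image_eq_zero_of_notMem_tsupport hx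
  have hdf0 : ∀ x ∉ tsupport f, fderiv ℝ f x = 0 := fun x hx =>
    image_eq_zero_of_notMem_tsupport fun h => hx (tsupport_fderiv_subset ℝ h)
  calc _ = ∫ x, f x * ∑ i, (fderiv ℝ (hypCoshField x₀) x (EuclideanSpace.single i 1)) i := by
        congr 1 with x
        by_cases hx : x ∈ tsupport f
        · rw [divergence_hypCoshField hx₀ (hfV hx)]; ring
        · simp [hf0 x hx]
    _ = _ := by
        rw [h]
        congr 2 with x
        by_cases hx : x ∈ tsupport f
        · rw [hypCoshField_eq hx₀ (hfV hx), map_smul, smul_eq_mul, mul_assoc]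
        · simp [hdf0 x hx]

/-! ### The gradient of the distance. -/

theorem differentiableAt_hypDist {N : ℕ} {x₀ x : EuclideanSpace ℝ (Fin N)} (hx₀ : x₀ ∈ hypSpace N)
    (hx : x ∈ hypSpace N) (hne : x ≠ x₀) : DifferentiableAt ℝ (hypDist x₀) x :=
  ((contDiffOn_hypDist hx₀).differentiableOn (by simp)).differentiableAt
    (((isOpen_hypSpace N).sdiff isClosed_singleton).mem_nhds ⟨hx, hne⟩)

/-- The chain rule and the closed form both differentiate cosh r; uniqueness of the derivative
identifies the results. -/
theorem sinh_smul_gradient_hypDist {N : ℕ} {x₀ x : EuclideanSpace ℝ (Fin N)}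
    (hx₀ : x₀ ∈ hypSpace N) (hx : x ∈ hypSpace N) (hne : x ≠ x₀) :
    Real.sinh (hypDist x₀ x) • gradient (hypDist x₀) x = hypCoshGrad x₀ x := by
  have h1 := (differentiableAt_hypDist hx₀ hx hne).hasGradientAt.hasFDerivAt.cosh
  have h2 : HasFDerivAt (fun y => Real.cosh (hypDist x₀ y)) (innerSL ℝ (hypCoshGrad x₀ x)) x :=
    (hasFDerivAt_hypCosh hx₀ hx).congr_of_eventuallyEq
      (Filter.eventually_of_mem ((isOpen_hypSpace N).mem_nhds hx) fun y hy => cosh_hypDist hx₀ hy)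
  have h3 := h1.unique h2
  refine ext_inner_right ℝ fun v => ?_
  have := DFunLike.congr_fun h3 v
  simpa [real_inner_smul_left] using this

/-- The eikonal equation |∇r| = 1: cancel sinh² r ≠ 0 in |∇cosh r|² = sinh² r. -/
theorem norm_sq_gradient_hypDist {N : ℕ} {x₀ x : EuclideanSpace ℝ (Fin N)}
    (hx₀ : x₀ ∈ hypSpace N) (hx : x ∈ hypSpace N) (hne : x ≠ x₀) :
    ‖gradient (hypDist x₀) x‖ ^ 2 = 4 / (1 - ‖x‖ ^ 2) ^ 2 := by
  have hs : Real.sinh (hypDist x₀ x) ^ 2 ≠ 0 :=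
    (pow_pos (Real.sinh_pos_iff.2 (hypDist_pos hx₀ hx hne)) 2).ne'
  have h := norm_sq_hypCoshGrad hx₀ hx
  rw [← sinh_smul_gradient_hypDist hx₀ hx hne, ← cosh_hypDist hx₀ hx, Real.cosh_sq,
    norm_smul, mul_pow, Real.norm_eq_abs, sq_abs] at h
  apply mul_left_cancel₀ hs
  rw [h]
  ring

/-! ### Integration against the hyperbolic volume. -/

theorem measurable_hypDensity (N : ℕ) : Measurable fun x : EuclideanSpace ℝ (Fin N) =>
    ENNReal.ofReal ((2 / (1 - ‖x‖ ^ 2)) ^ N) := by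
  fun_prop

/-- The density formula has no meaning off the ball; vanishing of `F` there permits an integral over
the whole Euclidean space, where integration by parts applies. -/
theorem integral_hypVolume {N : ℕ} {F : EuclideanSpace ℝ (Fin N) → ℝ}
    (h0 : ∀ x ∉ hypSpace N, F x = 0) :
    ∫ x, F x ∂(hypVolume N) = ∫ x, (2 / (1 - ‖x‖ ^ 2)) ^ N * F x := by
  rw [hypVolume, integral_withDensity_eq_integral_toReal_smul (measurable_hypDensity N)
    (by simp), ← setIntegral_eq_integral_of_forall_compl_eq_zero (s := hypSpace N)
      (f := fun x => (2 / (1 - ‖x‖ ^ 2)) ^ N * F x)]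
  · refine setIntegral_congr_fun (isOpen_hypSpace N).measurableSet fun x hx => ?_
    have := one_sub_norm_sq_pos hx
    simp only [smul_eq_mul]
    rw [ENNReal.toReal_ofReal (by positivity)]
  · intro x hx
    simp [h0 x hx]

theorem continuousOn_hypDensity (N : ℕ) : ContinuousOn
    (fun x : EuclideanSpace ℝ (Fin N) => (2 / (1 - ‖x‖ ^ 2)) ^ N) (hypSpace N) :=
  (continuousOn_const.div (by fun_prop) fun _ hx => (one_sub_norm_sq_pos hx).ne').pow N

theorem integrable_hypVolume {N : ℕ} {F : EuclideanSpace ℝ (Fin N) → ℝ}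
    {K : Set (EuclideanSpace ℝ (Fin N))} (hK : IsCompact K) (hKN : K ⊆ hypSpace N)
    (hF : ContinuousOn F K) (h0 : ∀ x ∉ K, F x = 0) : Integrable F (hypVolume N) := by
  rw [hypVolume, integrable_withDensity_iff_integrable_smul' (measurable_hypDensity N) (by simp)]
  have h : Integrable fun x => (2 / (1 - ‖x‖ ^ 2)) ^ N * F x :=
    integrable_of_continuousOn_of_eq_zero hK (((continuousOn_hypDensity N).mono hKN).mul hF)
      fun x hx => by simp [h0 x hx]
  refine (integrableOn_congr_fun (fun x hx => ?_) (isOpen_hypSpace N).measurableSet).1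
    h.integrableOn
  have := one_sub_norm_sq_pos hx
  simp only [smul_eq_mul]
  rw [ENNReal.toReal_ofReal (by positivity)]

/-! ### Full and radial gradients in Euclidean terms. -/

theorem gradient_eq_zero_of_notMem_tsupport {E : Type*} [NormedAddCommGroup E]
    [InnerProductSpace ℝ E] [CompleteSpace E] {f : E → ℝ} {x : E} (hx : x ∉ tsupport f) :
    gradient f x = 0 := by
  have : fderiv ℝ f x = 0 :=
    image_eq_zero_of_notMem_tsupport fun h => hx (tsupport_fderiv_subset ℝ h)
  simp [gradient, this]

/-- Meant for u² times a function of r, where the second factor is controlled only inside the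
punctured ball. -/
theorem contDiff_of_contDiffOn_of_tsupport_subset {E : Type*} [NormedAddCommGroup E]
    [NormedSpace ℝ E] {n : WithTop ℕ∞} {f : E → ℝ} {U : Set E} (hU : IsOpen U)
    (hf : ContDiffOn ℝ n f U) (hfU : tsupport f ⊆ U) : ContDiff ℝ n f := by
  rw [contDiff_iff_contDiffAt]
  intro x
  by_cases hx : x ∈ tsupport f
  · exact hf.contDiffAt (hU.mem_nhds (hfU hx))
  · exact contDiffAt_const.congr_of_eventuallyEq (notMem_tsupport_iff_eventuallyEq.1 hx)

theorem hypNormSq_hypGrad {N : ℕ} (u : EuclideanSpace ℝ (Fin N) → ℝ)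
    {x : EuclideanSpace ℝ (Fin N)} (hx : x ∈ hypSpace N) :
    hypNormSq x (hypGrad u x) = (1 - ‖x‖ ^ 2) ^ 2 / 4 * ‖gradient u x‖ ^ 2 := by
  have := one_sub_norm_sq_pos hx
  rw [hypNormSq, hypMetric, hypGrad, real_inner_smul_left, real_inner_smul_right,
    real_inner_self_eq_norm_sq]
  field_simp

/-- The radial derivative `∂u/∂r = g(∇u, ∇r)`. -/
noncomputable def hypRadialDeriv {N : ℕ} (x₀ : EuclideanSpace ℝ (Fin N))
    (u : EuclideanSpace ℝ (Fin N) → ℝ) (x : EuclideanSpace ℝ (Fin N)) : ℝ :=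
  (1 - ‖x‖ ^ 2) ^ 2 / 4 * inner ℝ (gradient u x) (gradient (hypDist x₀) x)

theorem hypNormSq_hypRadialGrad {N : ℕ} {x₀ x : EuclideanSpace ℝ (Fin N)}
    (hx₀ : x₀ ∈ hypSpace N) (hx : x ∈ hypSpace N) (hne : x ≠ x₀)
    (u : EuclideanSpace ℝ (Fin N) → ℝ) :
    hypNormSq x (hypRadialGrad x₀ u x) = hypRadialDeriv x₀ u x ^ 2 := by
  have h1 := one_sub_norm_sq_pos hx
  have h2 : hypMetric x (hypGrad u x) (hypGrad (hypDist x₀) x) = hypRadialDeriv x₀ u x := by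
    rw [hypMetric, hypGrad, hypGrad, real_inner_smul_left, real_inner_smul_right, hypRadialDeriv]
    field_simp
  have h3 := hypNormSq_hypGrad (hypDist x₀) hx
  rw [norm_sq_gradient_hypDist hx₀ hx hne, hypNormSq, hypMetric] at h3
  rw [hypNormSq, hypRadialGrad, h2, hypMetric, real_inner_smul_left, real_inner_smul_right]
  calc _ = hypRadialDeriv x₀ u x ^ 2 * (4 / (1 - ‖x‖ ^ 2) ^ 2 *
        inner ℝ (hypGrad (hypDist x₀) x) (hypGrad (hypDist x₀) x)) := by ring
    _ = _ := by rw [h3]; field_simp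

theorem hypNormSq_hypGrad_eq_zero {N : ℕ} {u : EuclideanSpace ℝ (Fin N) → ℝ}
    {x : EuclideanSpace ℝ (Fin N)} (hx : x ∉ tsupport u) : hypNormSq x (hypGrad u x) = 0 := by
  simp [hypNormSq, hypMetric, hypGrad, gradient_eq_zero_of_notMem_tsupport hx]

theorem hypNormSq_hypRadialGrad_eq_zero {N : ℕ} {x₀ : EuclideanSpace ℝ (Fin N)}
    {u : EuclideanSpace ℝ (Fin N) → ℝ}
    {x : EuclideanSpace ℝ (Fin N)} (hx : x ∉ tsupport u) :
    hypNormSq x (hypRadialGrad x₀ u x) = 0 := by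
  simp [hypNormSq, hypMetric, hypRadialGrad, hypGrad, gradient_eq_zero_of_notMem_tsupport hx]

theorem continuousOn_gradient {E : Type*} [NormedAddCommGroup E]
    [InnerProductSpace ℝ E] [CompleteSpace E] {f : E → ℝ} {U : Set E} (hU : IsOpen U)
    (hf : ContDiffOn ℝ 1 f U) : ContinuousOn (gradient f) U :=
  (InnerProductSpace.toDual ℝ E).symm.continuous.comp_continuousOn
    (hf.continuousOn_fderiv_of_isOpen hU le_rfl)

theorem continuousOn_hypRadialDeriv {N : ℕ} {x₀ : EuclideanSpace ℝ (Fin N)}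
    (hx₀ : x₀ ∈ hypSpace N) {u : EuclideanSpace ℝ (Fin N) → ℝ} (hu : ContDiff ℝ 1 u) :
    ContinuousOn (hypRadialDeriv x₀ u) (hypSpace N \ {x₀}) := by
  have hU : IsOpen (hypSpace N \ {x₀}) := (isOpen_hypSpace N).sdiff isClosed_singleton
  refine ContinuousOn.mul (by fun_prop) ?_
  exact (continuousOn_gradient hU hu.contDiffOn).inner
    (continuousOn_gradient hU ((contDiffOn_hypDist hx₀).of_le (by simp)))

/-! ### Pointwise expansion of the ground state quotient. -/

theorem gradient_div_comp_hypDist {N : ℕ} {x₀ x : EuclideanSpace ℝ (Fin N)}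
    (hx₀ : x₀ ∈ hypSpace N) (hx : x ∈ hypSpace N) (hne : x ≠ x₀)
    {u : EuclideanSpace ℝ (Fin N) → ℝ} (hu : DifferentiableAt ℝ u x) {ψ : ℝ → ℝ} {η : ℝ}
    (hψ0 : ψ (hypDist x₀ x) ≠ 0)
    (hψ : HasDerivAt ψ (η * ψ (hypDist x₀ x)) (hypDist x₀ x)) :
    gradient (fun z => u z / ψ (hypDist x₀ z)) x = (ψ (hypDist x₀ x))⁻¹ •
      (gradient u x - (u x * η) • gradient (hypDist x₀) x) := by
  refine HasGradientAt.gradient (hasGradientAt_iff_hasFDerivAt.2 ?_)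
  have h1 := hψ.comp_hasFDerivAt x (differentiableAt_hypDist hx₀ hx hne).hasGradientAt.hasFDerivAt
  have h2 := (hasDerivAt_inv hψ0).comp_hasFDerivAt x h1
  refine (hu.hasGradientAt.hasFDerivAt.mul h2).congr_fderiv ?_
  ext v
  simp
  field_simp
  ring

/-- Expand |∇u − uη∇r|² using |∇r| = 1. The cross term sees only ∂u/∂r, so the radial version has
the same lower-order terms. -/
theorem hypNormSq_hypGrad_div {N : ℕ} {x₀ x : EuclideanSpace ℝ (Fin N)}
    (hx₀ : x₀ ∈ hypSpace N) (hx : x ∈ hypSpace N) (hne : x ≠ x₀)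
    {u : EuclideanSpace ℝ (Fin N) → ℝ} (hu : DifferentiableAt ℝ u x) {ψ : ℝ → ℝ} {η : ℝ}
    (hψ0 : ψ (hypDist x₀ x) ≠ 0)
    (hψ : HasDerivAt ψ (η * ψ (hypDist x₀ x)) (hypDist x₀ x)) :
    ψ (hypDist x₀ x) ^ 2 * hypNormSq x (hypGrad (fun z => u z / ψ (hypDist x₀ z)) x) =
      hypNormSq x (hypGrad u x) - 2 * u x * η * hypRadialDeriv x₀ u x + u x ^ 2 * η ^ 2 := by
  have h1 := one_sub_norm_sq_pos hx
  rw [hypNormSq_hypGrad _ hx, hypNormSq_hypGrad _ hx,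
    gradient_div_comp_hypDist hx₀ hx hne hu hψ0 hψ, norm_smul, mul_pow, norm_sub_sq_real,
    norm_smul, mul_pow, norm_sq_gradient_hypDist hx₀ hx hne, real_inner_smul_right,
    Real.norm_eq_abs, Real.norm_eq_abs, sq_abs, sq_abs, hypRadialDeriv]
  field_simp

theorem hypNormSq_hypRadialGrad_div {N : ℕ} {x₀ x : EuclideanSpace ℝ (Fin N)}
    (hx₀ : x₀ ∈ hypSpace N) (hx : x ∈ hypSpace N) (hne : x ≠ x₀)
    {u : EuclideanSpace ℝ (Fin N) → ℝ} (hu : DifferentiableAt ℝ u x) {ψ : ℝ → ℝ} {η : ℝ}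
    (hψ0 : ψ (hypDist x₀ x) ≠ 0)
    (hψ : HasDerivAt ψ (η * ψ (hypDist x₀ x)) (hypDist x₀ x)) :
    ψ (hypDist x₀ x) ^ 2 * hypNormSq x (hypRadialGrad x₀ (fun z => u z / ψ (hypDist x₀ z)) x) =
      hypNormSq x (hypRadialGrad x₀ u x) - 2 * u x * η * hypRadialDeriv x₀ u x +
        u x ^ 2 * η ^ 2 := by
  have h1 := one_sub_norm_sq_pos hx
  have h2 : hypRadialDeriv x₀ (fun z => u z / ψ (hypDist x₀ z)) x =
      (ψ (hypDist x₀ x))⁻¹ * (hypRadialDeriv x₀ u x - u x * η) := by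
    rw [hypRadialDeriv, hypRadialDeriv, gradient_div_comp_hypDist hx₀ hx hne hu hψ0 hψ,
      real_inner_smul_left, inner_sub_left, real_inner_smul_left, real_inner_self_eq_norm_sq,
      norm_sq_gradient_hypDist hx₀ hx hne]
    field_simp
  rw [hypNormSq_hypRadialGrad hx₀ hx hne, hypNormSq_hypRadialGrad hx₀ hx hne, h2]
  field_simp
  ring

/-- Pairing with ∇cosh r = sinh r ∇r cancels the 1/sinh r of the test function; differentiating that
factor leaves −η coth r. -/
theorem fderiv_sq_mul_comp_hypDist {N : ℕ} {x₀ x : EuclideanSpace ℝ (Fin N)}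
    (hx₀ : x₀ ∈ hypSpace N) (hx : x ∈ hypSpace N) (hne : x ≠ x₀)
    {u : EuclideanSpace ℝ (Fin N) → ℝ} (hu : DifferentiableAt ℝ u x) {η : ℝ → ℝ} {η' : ℝ}
    (hη : HasDerivAt η η' (hypDist x₀ x)) :
    (1 - ‖x‖ ^ 2) ^ 2 / 4 *
      fderiv ℝ (fun z => u z ^ 2 * (η (hypDist x₀ z) / Real.sinh (hypDist x₀ z))) x
        (hypCoshGrad x₀ x) =
      2 * u x * η (hypDist x₀ x) * hypRadialDeriv x₀ u x + u x ^ 2 *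
        (η' - η (hypDist x₀ x) * (Real.cosh (hypDist x₀ x) / Real.sinh (hypDist x₀ x))) := by
  have h1 := one_sub_norm_sq_pos hx
  have hs := (Real.sinh_pos_iff.2 (hypDist_pos hx₀ hx hne)).ne'
  have hG := (hη.div (Real.hasDerivAt_sinh _) hs).comp_hasFDerivAt x
    (differentiableAt_hypDist hx₀ hx hne).hasGradientAt.hasFDerivAt
  have hf : fderiv ℝ (fun z => u z ^ 2 * (η (hypDist x₀ z) / Real.sinh (hypDist x₀ z))) x = _ :=
    HasFDerivAt.fderiv ((hu.hasGradientAt.hasFDerivAt.pow 2).mul hG)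
  rw [hf, ← sinh_smul_gradient_hypDist hx₀ hx hne, hypRadialDeriv]
  simp only [add_apply, smul_apply, smul_eq_mul, nsmul_eq_mul, map_smul,
    InnerProductSpace.toDual_apply_apply, real_inner_self_eq_norm_sq,
    norm_sq_gradient_hypDist hx₀ hx hne, Nat.add_one_sub_one, pow_one]
  field_simp
  ring

/-! ### The ground state representation for a general radial weight. -/

section GroundState

variable {N : ℕ} {x₀ : EuclideanSpace ℝ (Fin N)} {u : EuclideanSpace ℝ (Fin N) → ℝ}

theorem IsHypTestFunction.mem_hypSpace (hu : IsHypTestFunction x₀ u)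
    {x : EuclideanSpace ℝ (Fin N)} (hx : x ∈ tsupport u) : x ∈ hypSpace N :=
  (hu.tsupport_subset hx).1

theorem IsHypTestFunction.ne_pole (hu : IsHypTestFunction x₀ u)
    {x : EuclideanSpace ℝ (Fin N)} (hx : x ∈ tsupport u) : x ≠ x₀ :=
  (hu.tsupport_subset hx).2

theorem IsHypTestFunction.differentiable (hu : IsHypTestFunction x₀ u) : Differentiable ℝ u :=
  hu.contDiff.differentiable (by simp)

/-- Integrability of functions that are continuous away from the pole and vanish off the support
of a test function. -/
theorem IsHypTestFunction.integrable (hu : IsHypTestFunction x₀ u)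
    {F G : EuclideanSpace ℝ (Fin N) → ℝ} (hG : ContinuousOn G (hypSpace N \ {x₀}))
    (hFG : ∀ x ∈ tsupport u, F x = G x) (h0 : ∀ x ∉ tsupport u, F x = 0) :
    Integrable F (hypVolume N) :=
  integrable_hypVolume hu.hasCompactSupport (fun _ hx => hu.mem_hypSpace hx)
    ((hG.mono hu.tsupport_subset).congr hFG) h0

theorem ContinuousOn.comp_hypDist (hx₀ : x₀ ∈ hypSpace N) {φ : ℝ → ℝ}
    (hφ : ContinuousOn φ (Ioi 0)) :
    ContinuousOn (fun x => φ (hypDist x₀ x)) (hypSpace N \ {x₀}) :=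
  hφ.comp (contDiffOn_hypDist hx₀).continuousOn fun _ hx => hypDist_pos hx₀ hx.1 hx.2

theorem IsHypTestFunction.integrable_mul_sq (hu : IsHypTestFunction x₀ u)
    (hx₀ : x₀ ∈ hypSpace N) {φ : ℝ → ℝ} (hφ : ContinuousOn φ (Ioi 0)) :
    Integrable (fun x => φ (hypDist x₀ x) * u x ^ 2) (hypVolume N) := by
  refine hu.integrable ((ContinuousOn.comp_hypDist hx₀ hφ).mul
    (hu.contDiff.continuous.pow 2).continuousOn) (fun _ _ => rfl) fun x hx => ?_
  simp [image_eq_zero_of_notMem_tsupport hx]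

theorem continuousOn_normSqGrad (hu : IsHypTestFunction x₀ u) :
    ContinuousOn (fun x => (1 - ‖x‖ ^ 2) ^ 2 / 4 * ‖gradient u x‖ ^ 2) (hypSpace N \ {x₀}) := by
  have h : Continuous (gradient u) := continuousOn_univ.1
    (continuousOn_gradient isOpen_univ (hu.contDiff.of_le (by simp)).contDiffOn)
  fun_prop

theorem IsHypTestFunction.integrable_hypGrad (hu : IsHypTestFunction x₀ u) :
    Integrable (fun x => hypNormSq x (hypGrad u x)) (hypVolume N) :=
  hu.integrable (continuousOn_normSqGrad hu) (fun _ hx => hypNormSq_hypGrad u (hu.mem_hypSpace hx))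
    fun _ hx => hypNormSq_hypGrad_eq_zero hx

theorem IsHypTestFunction.integrable_hypRadialGrad (hu : IsHypTestFunction x₀ u)
    (hx₀ : x₀ ∈ hypSpace N) :
    Integrable (fun x => hypNormSq x (hypRadialGrad x₀ u x)) (hypVolume N) :=
  hu.integrable ((continuousOn_hypRadialDeriv hx₀ (hu.contDiff.of_le (by simp))).pow 2)
    (fun _ hx => hypNormSq_hypRadialGrad hx₀ (hu.mem_hypSpace hx) (hu.ne_pole hx) u)
    fun _ hx => hypNormSq_hypRadialGrad_eq_zero hx

theorem continuousOn_cross (hu : IsHypTestFunction x₀ u) (hx₀ : x₀ ∈ hypSpace N) {η : ℝ → ℝ}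
    (hη : ContinuousOn η (Ioi 0)) :
    ContinuousOn (fun x => 2 * u x * η (hypDist x₀ x) * hypRadialDeriv x₀ u x)
      (hypSpace N \ {x₀}) :=
  ((continuous_const.mul hu.contDiff.continuous).continuousOn.mul
    (ContinuousOn.comp_hypDist hx₀ hη)).mul
    (continuousOn_hypRadialDeriv hx₀ (hu.contDiff.of_le (by simp)))

theorem notMem_tsupport_div {v : EuclideanSpace ℝ (Fin N) → ℝ} {x : EuclideanSpace ℝ (Fin N)}
    (hx : x ∉ tsupport u) : x ∉ tsupport (fun z => u z / v z) := fun h => hx <| by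
  simp only [div_eq_mul_inv] at h
  exact tsupport_mul_subset_left h

/-- The weak form of `Δ H = H'' + (N - 1) coth r H'` for a function `H` of `r` with `H' = η`,
tested against `u ^ 2`. -/
theorem IsHypTestFunction.integral_cross (hu : IsHypTestFunction x₀ u) (hx₀ : x₀ ∈ hypSpace N)
    {η : ℝ → ℝ} (hη : ContDiffOn ℝ 1 η (Ioi 0)) :
    Integrable (fun x => 2 * u x * η (hypDist x₀ x) * hypRadialDeriv x₀ u x + u x ^ 2 *
      (deriv η (hypDist x₀ x) + ((N : ℝ) - 1) * (Real.cosh (hypDist x₀ x) /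
        Real.sinh (hypDist x₀ x)) * η (hypDist x₀ x))) (hypVolume N) ∧
    ∫ x, (2 * u x * η (hypDist x₀ x) * hypRadialDeriv x₀ u x + u x ^ 2 *
      (deriv η (hypDist x₀ x) + ((N : ℝ) - 1) * (Real.cosh (hypDist x₀ x) /
        Real.sinh (hypDist x₀ x)) * η (hypDist x₀ x))) ∂(hypVolume N) = 0 := by
  have hU : IsOpen (hypSpace N \ {x₀}) := (isOpen_hypSpace N).sdiff isClosed_singleton
  have hsinh : ∀ t ∈ Ioi (0 : ℝ), Real.sinh t ≠ 0 := fun t ht => (Real.sinh_pos_iff.2 ht).ne'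
  have hu0 : ∀ x ∉ tsupport u, u x = 0 := fun x hx => image_eq_zero_of_notMem_tsupport hx
  -- Dividing by sinh makes G(r)∇cosh r equal to η(r)∇r.
  set G : ℝ → ℝ := fun t => η t / Real.sinh t with hG
  have hGd : ContDiffOn ℝ 1 G (Ioi 0) := hη.div Real.contDiff_sinh.contDiffOn hsinh
  set f : EuclideanSpace ℝ (Fin N) → ℝ := fun x => u x ^ 2 * G (hypDist x₀ x) with hf
  have hfs : tsupport f ⊆ tsupport u := by
    refine (tsupport_mul_subset_left).trans ?_
    refine closure_mono fun x hx => ?_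
    simpa using hx
  have hfd : ContDiff ℝ 1 f := by
    refine contDiff_of_contDiffOn_of_tsupport_subset hU ?_ (hfs.trans hu.tsupport_subset)
    exact ((hu.contDiff.of_le (by simp)).pow 2).contDiffOn.mul
      (hGd.comp ((contDiffOn_hypDist hx₀).of_le (by simp)) fun x hx => hypDist_pos hx₀ hx.1 hx.2)
  have hfc : HasCompactSupport f := hu.hasCompactSupport.of_isClosed_subset
    (isClosed_tsupport f) hfs
  have hweak := integral_mul_hypCosh hx₀ hfd hfc
    (hfs.trans (hu.tsupport_subset.trans sdiff_subset))
  have hcoth : ContinuousOn (fun t => deriv η t + ((N : ℝ) - 1) * (Real.cosh t / Real.sinh t) * η t)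
      (Ioi 0) := (hη.continuousOn_deriv_of_isOpen isOpen_Ioi le_rfl).add
    ((continuousOn_const.mul (Real.continuous_cosh.continuousOn.div
      Real.continuous_sinh.continuousOn hsinh)).mul hη.continuousOn)
  have hcW := (continuousOn_cross hu hx₀ hη.continuousOn).add
    ((hu.contDiff.continuous.pow 2).continuousOn.mul (ContinuousOn.comp_hypDist hx₀ hcoth))
  have hW0 : ∀ x ∉ tsupport u, 2 * u x * η (hypDist x₀ x) * hypRadialDeriv x₀ u x + u x ^ 2 *
      (deriv η (hypDist x₀ x) + ((N : ℝ) - 1) * (Real.cosh (hypDist x₀ x) /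
        Real.sinh (hypDist x₀ x)) * η (hypDist x₀ x)) = 0 := fun x hx => by simp [hu0 x hx]
  refine ⟨hu.integrable hcW (fun _ _ => rfl) hW0, ?_⟩
  rw [integral_hypVolume fun x hx => hW0 x fun h => hx (hu.mem_hypSpace h)]
  -- The −η coth r from the derivative of 1/sinh combines with N η coth r from Δ cosh r to give the
  -- factor N − 1.
  have hpt : ∀ x, (2 / (1 - ‖x‖ ^ 2)) ^ N * (2 * u x * η (hypDist x₀ x) * hypRadialDeriv x₀ u x +
      u x ^ 2 * (deriv η (hypDist x₀ x) + ((N : ℝ) - 1) * (Real.cosh (hypDist x₀ x) /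
        Real.sinh (hypDist x₀ x)) * η (hypDist x₀ x))) =
      (2 / (1 - ‖x‖ ^ 2)) ^ N * ((1 - ‖x‖ ^ 2) ^ 2 / 4 * fderiv ℝ f x (hypCoshGrad x₀ x)) +
      (2 / (1 - ‖x‖ ^ 2)) ^ N * (N * hypCosh x₀ x * f x) := by
    intro x
    by_cases hx : x ∈ tsupport u
    · have hx1 := hu.mem_hypSpace hx
      have hx2 := hu.ne_pole hx
      have hr := hypDist_pos hx₀ hx1 hx2
      have hdη : HasDerivAt η (deriv η (hypDist x₀ x)) (hypDist x₀ x) :=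
        ((hη.differentiableOn one_ne_zero).differentiableAt (Ioi_mem_nhds hr)).hasDerivAt
      rw [fderiv_sq_mul_comp_hypDist hx₀ hx1 hx2 (hu.differentiable x) hdη, ← cosh_hypDist hx₀ hx1]
      simp only [hf, hG]
      ring
    · have hdf0 : fderiv ℝ f x = 0 :=
        image_eq_zero_of_notMem_tsupport fun h => hx (hfs (tsupport_fderiv_subset ℝ h))
      have hfx : f x = 0 := by simp [hf, hu0 x hx]
      rw [hW0 x hx, hdf0, hfx]
      simp
  have hi2 : Integrable fun x => (2 / (1 - ‖x‖ ^ 2)) ^ N * (N * hypCosh x₀ x * f x) := by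
    refine integrable_of_continuousOn_of_eq_zero hu.hasCompactSupport ?_
      fun x hx => by simp [hf, hu0 x hx]
    have hC : ContinuousOn (hypCosh x₀) (tsupport u) := fun x hx =>
      (hasFDerivAt_hypCosh hx₀ (hu.mem_hypSpace hx)).continuousAt.continuousWithinAt
    exact ((continuousOn_hypDensity N).mono fun x hx => hu.mem_hypSpace hx).mul
      ((continuousOn_const.mul hC).mul hfd.continuous.continuousOn)
  -- Obtained as a difference by `hpt`: the sum and the other summand are integrable by continuity
  -- on the support.
  have hi1 : Integrable fun x => (2 / (1 - ‖x‖ ^ 2)) ^ N *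
      ((1 - ‖x‖ ^ 2) ^ 2 / 4 * fderiv ℝ f x (hypCoshGrad x₀ x)) := by
    have hi : Integrable fun x => (2 / (1 - ‖x‖ ^ 2)) ^ N *
      (2 * u x * η (hypDist x₀ x) * hypRadialDeriv x₀ u x +
      u x ^ 2 * (deriv η (hypDist x₀ x) + ((N : ℝ) - 1) * (Real.cosh (hypDist x₀ x) /
        Real.sinh (hypDist x₀ x)) * η (hypDist x₀ x))) :=
      integrable_of_continuousOn_of_eq_zero hu.hasCompactSupport
        (((continuousOn_hypDensity N).mono fun x hx => hu.mem_hypSpace hx).mul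
          (hcW.mono hu.tsupport_subset)) fun x hx => by rw [hW0 x hx, mul_zero]
    refine (hi.sub hi2).congr (Filter.Eventually.of_forall fun x => ?_)
    simp only [Pi.sub_apply, hpt x, add_sub_cancel_right]
  simp only [hpt]
  rw [integral_add hi1 hi2, hweak, add_neg_cancel]

/-- The ground state representation for a radial weight `ψ(r)` with logarithmic derivative `η`. -/
theorem IsHypTestFunction.integral_hypGrad_eq (hu : IsHypTestFunction x₀ u)
    (hx₀ : x₀ ∈ hypSpace N) {ψ η V : ℝ → ℝ} (hη : ContDiffOn ℝ 1 η (Ioi 0))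
    (hV : ContinuousOn V (Ioi 0)) (hψ0 : ∀ t, 0 < t → ψ t ≠ 0)
    (hψ : ∀ t, 0 < t → HasDerivAt ψ (η t * ψ t) t)
    (hVη : ∀ t, 0 < t →
      V t = -(deriv η t + ((N : ℝ) - 1) * (Real.cosh t / Real.sinh t) * η t + η t ^ 2)) :
    (Integrable (fun x => ψ (hypDist x₀ x) ^ 2 *
        hypNormSq x (hypGrad (fun z => u z / ψ (hypDist x₀ z)) x)) (hypVolume N) ∧
      Integrable (fun x => ψ (hypDist x₀ x) ^ 2 *
        hypNormSq x (hypRadialGrad x₀ (fun z => u z / ψ (hypDist x₀ z)) x)) (hypVolume N)) ∧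
    (∫ x, hypNormSq x (hypGrad u x) ∂(hypVolume N) =
      ∫ x, V (hypDist x₀ x) * u x ^ 2 ∂(hypVolume N) +
      ∫ x, ψ (hypDist x₀ x) ^ 2 *
        hypNormSq x (hypGrad (fun z => u z / ψ (hypDist x₀ z)) x) ∂(hypVolume N)) ∧
    (∫ x, hypNormSq x (hypRadialGrad x₀ u x) ∂(hypVolume N) =
      ∫ x, V (hypDist x₀ x) * u x ^ 2 ∂(hypVolume N) +
      ∫ x, ψ (hypDist x₀ x) ^ 2 *
        hypNormSq x (hypRadialGrad x₀ (fun z => u z / ψ (hypDist x₀ z)) x) ∂(hypVolume N)) := by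
  have hu0 : ∀ x ∉ tsupport u, u x = 0 := fun x hx => image_eq_zero_of_notMem_tsupport hx
  obtain ⟨hW, hW0⟩ := hu.integral_cross hx₀ hη
  have hVi := hu.integrable_mul_sq hx₀ hV
  have hcr := continuousOn_cross hu hx₀ hη.continuousOn
  have hsq := (hu.contDiff.continuous.pow 2).continuousOn.mul
    (ContinuousOn.comp_hypDist hx₀ (hη.continuousOn.pow 2))
  have e1 : ∀ x ∈ tsupport u, _ := fun x hx =>
    hypNormSq_hypGrad_div hx₀ (hu.mem_hypSpace hx) (hu.ne_pole hx) (hu.differentiable x)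
      (hψ0 _ (hypDist_pos hx₀ (hu.mem_hypSpace hx) (hu.ne_pole hx)))
      (hψ _ (hypDist_pos hx₀ (hu.mem_hypSpace hx) (hu.ne_pole hx)))
  have e2 : ∀ x ∈ tsupport u, _ := fun x hx =>
    hypNormSq_hypRadialGrad_div hx₀ (hu.mem_hypSpace hx) (hu.ne_pole hx) (hu.differentiable x)
      (hψ0 _ (hypDist_pos hx₀ (hu.mem_hypSpace hx) (hu.ne_pole hx)))
      (hψ _ (hypDist_pos hx₀ (hu.mem_hypSpace hx) (hu.ne_pole hx)))
  have z1 : ∀ x ∉ tsupport u, ψ (hypDist x₀ x) ^ 2 *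
        hypNormSq x (hypGrad (fun z => u z / ψ (hypDist x₀ z)) x) = 0 := fun x hx => by
    rw [hypNormSq_hypGrad_eq_zero (notMem_tsupport_div hx), mul_zero]
  have z2 : ∀ x ∉ tsupport u, ψ (hypDist x₀ x) ^ 2 *
        hypNormSq x (hypRadialGrad x₀ (fun z => u z / ψ (hypDist x₀ z)) x) = 0 := fun x hx => by
    rw [hypNormSq_hypRadialGrad_eq_zero (notMem_tsupport_div hx), mul_zero]
  have i1 := hu.integrable (((continuousOn_normSqGrad hu).sub hcr).add hsq)
    (fun x hx => (e1 x hx).trans (by rw [hypNormSq_hypGrad u (hu.mem_hypSpace hx)]; rfl)) z1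
  have i2 := hu.integrable ((((continuousOn_hypRadialDeriv hx₀
      (hu.contDiff.of_le (by simp))).pow 2).sub hcr).add hsq)
    (fun x hx => (e2 x hx).trans
      (by rw [hypNormSq_hypRadialGrad hx₀ (hu.mem_hypSpace hx) (hu.ne_pole hx) u]; rfl)) z2
  refine ⟨⟨i1, i2⟩, ?_, ?_⟩
  -- Adding the vanishing integral `hW0` makes the two integrands equal pointwise.
  · rw [← add_zero (_ + _), ← hW0, ← integral_add hVi i1, ← integral_add (hVi.fun_add i1) hW]
    congr 1 with x
    by_cases hx : x ∈ tsupport u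
    · rw [e1 x hx, hVη _ (hypDist_pos hx₀ (hu.mem_hypSpace hx) (hu.ne_pole hx))]
      ring
    · rw [z1 x hx, hypNormSq_hypGrad_eq_zero hx, hu0 x hx]
      ring
  · rw [← add_zero (_ + _), ← hW0, ← integral_add hVi i2, ← integral_add (hVi.fun_add i2) hW]
    congr 1 with x
    by_cases hx : x ∈ tsupport u
    · rw [e2 x hx, hVη _ (hypDist_pos hx₀ (hu.mem_hypSpace hx) (hu.ne_pole hx))]
      ring
    · rw [z2 x hx, hypNormSq_hypRadialGrad_eq_zero hx, hu0 x hx]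
      ring

end GroundState

/-! ### The weight Ψ_λ and its potential. -/

/-- The logarithmic derivative of `PsiN N lam`. -/
noncomputable def etaN (N : ℕ) (lam t : ℝ) : ℝ :=
  hN N lam / t - ((N : ℝ) - 1 + gammaN N lam) / 2 * (Real.cosh t / Real.sinh t)

/-- The potential of the Hardy-type identity. -/
noncomputable def potentialN (N : ℕ) (lam t : ℝ) : ℝ :=
  lam + hN N lam ^ 2 / t ^ 2 + (((N : ℝ) - 2) ^ 2 / 4 - hN N lam ^ 2) / Real.sinh t ^ 2 +
    gammaN N lam * hN N lam * cothWeight t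

theorem PsiN_pos {N : ℕ} {lam t : ℝ} (ht : 0 < t) : 0 < PsiN N lam t := by
  have := Real.sinh_pos_iff.2 ht
  unfold PsiN
  positivity

/-- With a = (N−1+γ)/2, the logarithmic derivative is −(N−2)/(2t) − a(coth t − 1/t), and a − (N−2)/2
= (γ+1)/2 is exactly h. -/
theorem hasDerivAt_PsiN {N : ℕ} {lam t : ℝ} (ht : 0 < t) :
    HasDerivAt (PsiN N lam) (etaN N lam t * PsiN N lam t) t := by
  have hs := Real.sinh_pos_iff.2 ht
  have hq : 0 < Real.sinh t / t := by positivity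
  have h1 := (hasDerivAt_id t).rpow_const (p := -(((N : ℝ) - 2) / 2)) (Or.inl ht.ne')
  have h2 := ((Real.hasDerivAt_sinh t).div (hasDerivAt_id t) ht.ne').rpow_const
    (p := -(((N : ℝ) - 1 + gammaN N lam) / 2)) (Or.inl hq.ne')
  refine (h1.mul h2).congr_deriv ?_
  simp only [id, Pi.div_apply, Real.rpow_sub_one ht.ne', Real.rpow_sub_one hq.ne', PsiN, etaN, hN]
  field_simp
  ring

theorem hasDerivAt_etaN {N : ℕ} {lam t : ℝ} (ht : 0 < t) :
    HasDerivAt (etaN N lam)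
      (-(hN N lam / t ^ 2) + ((N : ℝ) - 1 + gammaN N lam) / 2 / Real.sinh t ^ 2) t := by
  have hs := (Real.sinh_pos_iff.2 ht).ne'
  have h1 := (hasDerivAt_inv ht.ne').const_mul (hN N lam)
  have h2 := ((Real.hasDerivAt_cosh t).div (Real.hasDerivAt_sinh t) hs).const_mul
    (((N : ℝ) - 1 + gammaN N lam) / 2)
  refine (h1.sub h2).congr_deriv ?_
  have := Real.cosh_sq t
  field_simp
  linear_combination ((N : ℝ) - 1 + gammaN N lam) * t ^ 2 * this

theorem contDiffOn_etaN (N : ℕ) (lam : ℝ) : ContDiffOn ℝ 1 (etaN N lam) (Ioi 0) :=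
  (contDiffOn_const.div contDiffOn_id fun _ ht => (ne_of_gt ht)).sub
    (contDiffOn_const.mul (Real.contDiff_cosh.contDiffOn.div Real.contDiff_sinh.contDiffOn
      fun _ ht => (Real.sinh_pos_iff.2 ht).ne'))

theorem continuousOn_cothWeight : ContinuousOn cothWeight (Ioi 0) :=
  ((continuousOn_id.mul (Real.continuous_cosh.continuousOn.div Real.continuous_sinh.continuousOn
    fun _ ht => (Real.sinh_pos_iff.2 ht).ne')).sub continuousOn_const).div
    (continuousOn_id.pow 2) fun _ ht => pow_ne_zero 2 (ne_of_gt ht)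

theorem continuousOn_inv_sq : ContinuousOn (fun t : ℝ => (t ^ 2)⁻¹) (Ioi 0) :=
  (continuousOn_id.pow 2).inv₀ fun _ ht => pow_ne_zero 2 (ne_of_gt ht)

theorem continuousOn_inv_sinh_sq : ContinuousOn (fun t => (Real.sinh t ^ 2)⁻¹) (Ioi 0) :=
  (Real.continuous_sinh.continuousOn.pow 2).inv₀
    fun _ ht => pow_ne_zero 2 (Real.sinh_pos_iff.2 ht).ne'

theorem continuousOn_potentialN (N : ℕ) (lam : ℝ) : ContinuousOn (potentialN N lam) (Ioi 0) := by
  unfold potentialN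
  simp only [div_eq_mul_inv _ (_ ^ 2)]
  exact ((continuousOn_const.add (continuousOn_const.mul continuousOn_inv_sq)).add
    (continuousOn_const.mul continuousOn_inv_sinh_sq)).add
    (continuousOn_const.mul continuousOn_cothWeight)

/-- In V the coefficient of coth² is ((N−1)² − γ²)/4 = λ, and coth² = 1 + 1/sinh² splits it into the
spectral term and a 1/sinh² term. The mixed term γh coth t / t is γh times `cothWeight` plus γh/t²,
and h − h² + γh = h² since γ = 2h − 1. The bound on λ keeps the radicand of γ nonnegative. -/
theorem potentialN_eq {N : ℕ} {lam t : ℝ} (hlam : lam ≤ (((N : ℝ) - 1) / 2) ^ 2) (ht : 0 < t) :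
    potentialN N lam t = -(deriv (etaN N lam) t +
      ((N : ℝ) - 1) * (Real.cosh t / Real.sinh t) * etaN N lam t + etaN N lam t ^ 2) := by
  have hs := (Real.sinh_pos_iff.2 ht).ne'
  have hγ : gammaN N lam ^ 2 = ((N : ℝ) - 1) ^ 2 - 4 * lam := Real.sq_sqrt (by linarith)
  rw [(hasDerivAt_etaN ht).deriv, potentialN, etaN, cothWeight]
  have hc : (Real.cosh t / Real.sinh t) ^ 2 = 1 + (Real.sinh t)⁻¹ ^ 2 := by
    rw [div_pow, Real.cosh_sq]
    field_simp
  have hw : (t * (Real.cosh t / Real.sinh t) - 1) / t ^ 2 =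
      Real.cosh t / Real.sinh t * t⁻¹ - t⁻¹ ^ 2 := by
    field_simp
  rw [hw]
  simp only [div_eq_mul_inv _ t, div_eq_mul_inv _ (_ ^ 2), ← inv_pow]
  -- In the variables coth t, 1/sinh t and 1/t the claim is a polynomial identity modulo `hc` and
  -- `hγ`.
  generalize Real.cosh t / Real.sinh t = c at *
  generalize (Real.sinh t)⁻¹ = i at *
  generalize t⁻¹ = j at *
  rw [hN]
  linear_combination (-(((N : ℝ) - 1) ^ 2 - gammaN N lam ^ 2) / 4) * hc + 1 / 4 * hγ

theorem IsHypTestFunction.integral_potentialN {N : ℕ} {x₀ : EuclideanSpace ℝ (Fin N)}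
    {u : EuclideanSpace ℝ (Fin N) → ℝ} (hu : IsHypTestFunction x₀ u) (hx₀ : x₀ ∈ hypSpace N)
    (lam : ℝ) :
    (Integrable (fun x => u x ^ 2) (hypVolume N) ∧
      Integrable (fun x => u x ^ 2 / hypDist x₀ x ^ 2) (hypVolume N) ∧
      Integrable (fun x => u x ^ 2 / Real.sinh (hypDist x₀ x) ^ 2) (hypVolume N) ∧
      Integrable (fun x => cothWeight (hypDist x₀ x) * u x ^ 2) (hypVolume N)) ∧
    ∫ x, potentialN N lam (hypDist x₀ x) * u x ^ 2 ∂(hypVolume N) =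
      lam * (∫ x, u x ^ 2 ∂(hypVolume N)) +
        hN N lam ^ 2 * (∫ x, u x ^ 2 / hypDist x₀ x ^ 2 ∂(hypVolume N)) +
        (((N : ℝ) - 2) ^ 2 / 4 - hN N lam ^ 2) *
          (∫ x, u x ^ 2 / Real.sinh (hypDist x₀ x) ^ 2 ∂(hypVolume N)) +
        gammaN N lam * hN N lam *
          (∫ x, cothWeight (hypDist x₀ x) * u x ^ 2 ∂(hypVolume N)) := by
  have i1 : Integrable (fun x => u x ^ 2) (hypVolume N) := by
    simpa using hu.integrable_mul_sq hx₀ (continuousOn_const (c := (1 : ℝ)))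
  have i2 : Integrable (fun x => u x ^ 2 / hypDist x₀ x ^ 2) (hypVolume N) := by
    simpa only [div_eq_inv_mul] using hu.integrable_mul_sq hx₀ continuousOn_inv_sq
  have i3 : Integrable (fun x => u x ^ 2 / Real.sinh (hypDist x₀ x) ^ 2) (hypVolume N) := by
    simpa only [div_eq_inv_mul] using hu.integrable_mul_sq hx₀ continuousOn_inv_sinh_sq
  have i4 := hu.integrable_mul_sq hx₀ continuousOn_cothWeight
  refine ⟨⟨i1, i2, i3, i4⟩, ?_⟩
  simp only [← integral_const_mul]
  rw [← integral_add (i1.const_mul _) (i2.const_mul _),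
    ← integral_add ((i1.const_mul _).fun_add (i2.const_mul _)) (i3.const_mul _),
    ← integral_add (((i1.const_mul _).fun_add (i2.const_mul _)).fun_add (i3.const_mul _))
      (i4.const_mul _)]
  congr 1 with x
  rw [potentialN]
  ring

/-! ### The Hardy case λ = N − 2 and the final theorem. -/

/-- Here (N−1)² − 4(N−2) = (N−3)², and N ≥ 3 fixes the sign of the root. -/
theorem gammaN_sub_two {N : ℕ} (hN3 : 3 ≤ N) : gammaN N ((N : ℝ) - 2) = (N : ℝ) - 3 := by
  have : (3 : ℝ) ≤ N := by exact_mod_cast hN3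
  rw [gammaN, ← Real.sqrt_sq (by linarith : (0 : ℝ) ≤ (N : ℝ) - 3)]
  congr 1
  ring

/-- This value of h makes the coefficient of the 1/sinh² integral vanish. -/
theorem hN_sub_two {N : ℕ} (hN3 : 3 ≤ N) : hN N ((N : ℝ) - 2) = ((N : ℝ) - 2) / 2 := by
  rw [hN, gammaN_sub_two hN3]
  ring

theorem PsiN_sub_two {N : ℕ} (hN3 : 3 ≤ N) {t : ℝ} (ht : 0 < t) :
    PsiN N ((N : ℝ) - 2) t = t ^ (((N : ℝ) - 2) / 2) / Real.sinh t ^ ((N : ℝ) - 2) := by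
  have hs := Real.sinh_pos_iff.2 ht
  have e : ((N : ℝ) - 1 + ((N : ℝ) - 3)) / 2 = (N : ℝ) - 2 := by ring
  have h2 : t ^ ((N : ℝ) - 2) = t ^ (((N : ℝ) - 2) / 2) * t ^ (((N : ℝ) - 2) / 2) := by
    rw [← Real.rpow_add ht, add_halves]
  rw [PsiN, gammaN_sub_two hN3, e, Real.rpow_neg ht.le, Real.rpow_neg (by positivity),
    Real.div_rpow hs.le ht.le, h2]
  field_simp

theorem PsiN_sub_two_sq {N : ℕ} (hN3 : 3 ≤ N) {t : ℝ} (ht : 0 < t) :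
    PsiN N ((N : ℝ) - 2) t ^ 2 = (t ^ (1 / 2 : ℝ) / Real.sinh t) ^ (2 * ((N : ℝ) - 2)) := by
  have hs := Real.sinh_pos_iff.2 ht
  rw [PsiN_sub_two hN3 ht, Real.div_rpow (by positivity) hs.le, ← Real.rpow_mul ht.le, div_pow,
    ← Real.rpow_mul_natCast ht.le, ← Real.rpow_mul_natCast hs.le]
  congr 2 <;> push_cast <;> ring

theorem theoremA1 (N : ℕ) (hN2 : 2 ≤ N)
    (x₀ : EuclideanSpace ℝ (Fin N)) (hx₀ : x₀ ∈ hypSpace N)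
    (u : EuclideanSpace ℝ (Fin N) → ℝ) (hu : IsHypTestFunction x₀ u) :
    (∀ lam : ℝ, 0 ≤ lam → lam ≤ (((N : ℝ) - 1) / 2) ^ 2 →
      -- all the integrals are finite
      (Integrable (fun x => hypNormSq x (hypGrad u x)) (hypVolume N) ∧
        Integrable (fun x => hypNormSq x (hypRadialGrad x₀ u x)) (hypVolume N) ∧
        Integrable (fun x => u x ^ 2) (hypVolume N) ∧
        Integrable (fun x => u x ^ 2 / hypDist x₀ x ^ 2) (hypVolume N) ∧
        Integrable (fun x => u x ^ 2 / Real.sinh (hypDist x₀ x) ^ 2) (hypVolume N) ∧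
        Integrable (fun x => cothWeight (hypDist x₀ x) * u x ^ 2) (hypVolume N) ∧
        Integrable (fun x => PsiN N lam (hypDist x₀ x) ^ 2 *
          hypNormSq x (hypGrad (fun z => u z / PsiN N lam (hypDist x₀ z)) x)) (hypVolume N) ∧
        Integrable (fun x => PsiN N lam (hypDist x₀ x) ^ 2 *
          hypNormSq x (hypRadialGrad x₀ (fun z => u z / PsiN N lam (hypDist x₀ z)) x))
          (hypVolume N)) ∧
      -- the identity for the full gradient
      (∫ x, hypNormSq x (hypGrad u x) ∂(hypVolume N) =
        lam * (∫ x, u x ^ 2 ∂(hypVolume N)) +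
        hN N lam ^ 2 * (∫ x, u x ^ 2 / hypDist x₀ x ^ 2 ∂(hypVolume N)) +
        (((N : ℝ) - 2) ^ 2 / 4 - hN N lam ^ 2) *
          (∫ x, u x ^ 2 / Real.sinh (hypDist x₀ x) ^ 2 ∂(hypVolume N)) +
        gammaN N lam * hN N lam *
          (∫ x, cothWeight (hypDist x₀ x) * u x ^ 2 ∂(hypVolume N)) +
        ∫ x, PsiN N lam (hypDist x₀ x) ^ 2 *
          hypNormSq x (hypGrad (fun z => u z / PsiN N lam (hypDist x₀ z)) x)
            ∂(hypVolume N)) ∧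
      -- the identity for the radial gradient
      (∫ x, hypNormSq x (hypRadialGrad x₀ u x) ∂(hypVolume N) =
        lam * (∫ x, u x ^ 2 ∂(hypVolume N)) +
        hN N lam ^ 2 * (∫ x, u x ^ 2 / hypDist x₀ x ^ 2 ∂(hypVolume N)) +
        (((N : ℝ) - 2) ^ 2 / 4 - hN N lam ^ 2) *
          (∫ x, u x ^ 2 / Real.sinh (hypDist x₀ x) ^ 2 ∂(hypVolume N)) +
        gammaN N lam * hN N lam *
          (∫ x, cothWeight (hypDist x₀ x) * u x ^ 2 ∂(hypVolume N)) +
        ∫ x, PsiN N lam (hypDist x₀ x) ^ 2 *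
          hypNormSq x (hypRadialGrad x₀ (fun z => u z / PsiN N lam (hypDist x₀ z)) x)
            ∂(hypVolume N))) ∧
    -- the Hardy identity (the case `lam = N - 2`)
    (3 ≤ N →
      Integrable (fun x => (hypDist x₀ x ^ (1 / 2 : ℝ) / Real.sinh (hypDist x₀ x)) ^
          (2 * ((N : ℝ) - 2)) *
        hypNormSq x (hypGrad (fun z => Real.sinh (hypDist x₀ z) ^ ((N : ℝ) - 2) * u z /
          hypDist x₀ z ^ (((N : ℝ) - 2) / 2)) x)) (hypVolume N) ∧
      ∫ x, hypNormSq x (hypGrad u x) ∂(hypVolume N) =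
        (((N : ℝ) - 2) / 2) ^ 2 * (∫ x, u x ^ 2 / hypDist x₀ x ^ 2 ∂(hypVolume N)) +
        ((N : ℝ) - 2) * (∫ x, u x ^ 2 ∂(hypVolume N)) +
        ((N : ℝ) - 2) * ((N : ℝ) - 3) / 2 *
          (∫ x, cothWeight (hypDist x₀ x) * u x ^ 2 ∂(hypVolume N)) +
        ∫ x, (hypDist x₀ x ^ (1 / 2 : ℝ) / Real.sinh (hypDist x₀ x)) ^ (2 * ((N : ℝ) - 2)) *
          hypNormSq x (hypGrad (fun z => Real.sinh (hypDist x₀ z) ^ ((N : ℝ) - 2) * u z /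
            hypDist x₀ z ^ (((N : ℝ) - 2) / 2)) x) ∂(hypVolume N)) := by
  have main := fun (lam : ℝ) (hlam : lam ≤ (((N : ℝ) - 1) / 2) ^ 2) =>
    hu.integral_hypGrad_eq (ψ := PsiN N lam) (η := etaN N lam) (V := potentialN N lam) hx₀
      (contDiffOn_etaN N lam) (continuousOn_potentialN N lam) (fun t ht => (PsiN_pos ht).ne')
      (fun t ht => hasDerivAt_PsiN ht) (fun t ht => potentialN_eq hlam ht)
  refine ⟨fun lam _ hlam => ?_, fun hN3 => ?_⟩
  · obtain ⟨⟨i1, i2, i3, i4⟩, hpot⟩ := hu.integral_potentialN hx₀ lam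
    obtain ⟨⟨j1, j2⟩, h1, h2⟩ := main lam hlam
    rw [hpot] at h1 h2
    exact ⟨⟨hu.integrable_hypGrad, hu.integrable_hypRadialGrad hx₀, i1, i2, i3, i4, j1, j2⟩, h1, h2⟩
  · obtain ⟨-, hpot⟩ := hu.integral_potentialN hx₀ ((N : ℝ) - 2)
    -- The condition N − 2 ≤ ((N−1)/2)² is (N−3)² ≥ 0.
    obtain ⟨⟨j1, -⟩, h1, -⟩ := main ((N : ℝ) - 2) (by nlinarith [sq_nonneg ((N : ℝ) - 3)])
    have hr : ∀ x ∈ tsupport u, 0 < hypDist x₀ x := fun x hx =>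
      hypDist_pos hx₀ (hu.mem_hypSpace hx) (hu.ne_pole hx)
    -- Equality is needed at every point, since a gradient is taken; off the support both sides
    -- vanish with `u`.
    have hv : (fun z => Real.sinh (hypDist x₀ z) ^ ((N : ℝ) - 2) * u z /
        hypDist x₀ z ^ (((N : ℝ) - 2) / 2)) =
        fun z => u z / PsiN N ((N : ℝ) - 2) (hypDist x₀ z) := by
      ext z
      by_cases hz : z ∈ tsupport u
      · rw [PsiN_sub_two hN3 (hr z hz), div_div_eq_mul_div, mul_comm]
      · simp [image_eq_zero_of_notMem_tsupport hz]
    -- The two weights are compared only where r > 0 is known; off the support the gradient factor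
    -- is zero.
    have hF : (fun x => (hypDist x₀ x ^ (1 / 2 : ℝ) / Real.sinh (hypDist x₀ x)) ^
          (2 * ((N : ℝ) - 2)) *
        hypNormSq x (hypGrad (fun z => Real.sinh (hypDist x₀ z) ^ ((N : ℝ) - 2) * u z /
          hypDist x₀ z ^ (((N : ℝ) - 2) / 2)) x)) =
        fun x => PsiN N ((N : ℝ) - 2) (hypDist x₀ x) ^ 2 * hypNormSq x
          (hypGrad (fun z => u z / PsiN N ((N : ℝ) - 2) (hypDist x₀ z)) x) := by
      rw [hv]
      ext x
      by_cases hx : x ∈ tsupport u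
      · rw [PsiN_sub_two_sq hN3 (hr x hx)]
      · rw [hypNormSq_hypGrad_eq_zero (notMem_tsupport_div hx), mul_zero, mul_zero]
    rw [hF]
    refine ⟨j1, ?_⟩
    rw [h1, hpot, hN_sub_two hN3, gammaN_sub_two hN3]
    ring
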